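/- **Theorem (Estimating constrained modes).** Let $d\ge 0$ be an integer, $0<\alpha\le 1$, and let $C_\alpha,\check C,\hat C,r_M,\lambda,c>0$, $C_0>0$ and $\delta\in(0,1)$. There is a function $N:\mathbb R^2\to\mathbb N$, depending only on these numbers, such that the following holds. Let $\mathcal X\subset\mathbb R^d$ be compact with $\mathrm{vol}(B(x,\rho)\cap\mathcal X)\ge c\rho^d$ for all $x\in\mathcal X$ and $0<\rho\le 1$. Let $f$ be a probability density on $[0,1]\times\mathcal X$, and put $f_X(x)=\int_0^1 f(s,x)\,ds$ and $f(r|X=x)=f(r,x)/f_X(x)$. A *mode* of a function $g$ on $[0,1]$ is a strict local maximum of $g$ relative to $[0,1]$. Assume: 1. $|f(r,x)-f(r',x')|\le C_\alpha|(r,x)-(r',x')|^\alpha$ for all $r,r'\in[0,1]$, $x,x'\in\mathcal X$ (Euclidean norm of $\mathbb R^{d+1}$). 2. For every $x\in\mathcal X$ the local maxima of $f(\cdot|X=x)$ are points: every connected set $M\subseteq[0,1]$ on which $f(\cdot|X=x)$ is constant, and which has a neighbourhood in $[0,1]$ on which $f(\cdot|X=x)$ is strictly smaller outside $M$, is a single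 point. 3. For all $x\in\mathcal X$, all modes $r_0$ of $f(\cdot|X=x)$ and all $r\in[0,1]$ with $|r-r_0|\le r_M$: $\check C(r_0-r)^2\le|f(r_0,x)-f(r,x)|\le\hat C(r_0-r)^2$. 4. For the same $x,r_0,r$: $f(r,x)\ge\lambda$. 5. For every $x\in\mathcal X$, $f(\cdot|X=x)$ has a unique highest point in $[0,1]$, denoted $\mathrm{mode}(f(r|X=x))$. Then there are $B\in\mathbb R$ and $\gamma>0$ such that (i) $f\le B$ on $[0,1]\times\mathcal X$, and (ii) $f(r,x)+\gamma\le f(r_0,x)$ for all $x\in\mathcal X$, $r_0=\mathrm{mode}(f(r|X=x))$ and $r\in[0,1]$ with $|r-r_0|\ge r_M$. Moreover, for all $B$ and all $\gamma>0$ satisfying (i) and (ii), all $n\ge N(B,\gamma)$, every integer $k\ge 0$ with $|k-n^{2\alpha/(2\alpha+d+1)}|<1$ (that is, $k=n^{2\alpha/(2\alpha+d+1)}$ up to rounding), and $m=k^2$: $$\mathbb P\Bigl(\sup_{x\in\mathcal X}\bigl|\widehat{\mathrm{mode}}(S_{[n]},x)-\mathrm{mode}(f(r|X=x))\bigr|\ge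 C_0\frac{\sqrt{\log(1/\delta)}\,\log n}{n^{\alpha/(4\alpha+2d+2)}}\Bigr)\le\delta,$$ where $S_{[n]}=\{(r_1,X_1),\dots,(r_n,X_n)\}$ are i.i.d. samples from $f$, and $\widehat{\mathrm{mode}}(S_{[n]},x)\in\operatorname{argmin}_{r\in\{1/m,\dots,(m-1)/m\}}r_k(r,x)$, with ties broken arbitrarily, $r_k(r,x)$ being the Euclidean distance in $\mathbb R^{d+1}$ from $(r,x)$ to its $k$-th nearest neighbour in $S_{[n]}$. -/

import Mathlib

open MeasureTheory Set

noncomputable section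

namespace CondMode

/-- The context space `ℝ^d` with the Euclidean norm. -/
abbrev Ctx (d : ℕ) := EuclideanSpace ℝ (Fin d)

/-- Euclidean distance between two reward-context pairs, seen as vectors of `ℝ^(d+1)`
(the product type `ℝ × ℝ^d` itself carries the sup distance). -/
def jointDist {d : ℕ} (p q : ℝ × Ctx d) : ℝ :=
  Real.sqrt ((p.1 - q.1) ^ 2 + ‖p.2 - q.2‖ ^ 2)

/-! ### The estimator -/

/-- Distance from `p` to its `k`-th nearest neighbour in the sample `S` (with multiplicity):
the least radius whose closed ball around `p` holds at least `k` sample points. -/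
def knnRadius {d n : ℕ} (S : Fin n → ℝ × Ctx d) (k : ℕ) (p : ℝ × Ctx d) : ℝ :=
  sInf {ρ : ℝ | 0 ≤ ρ ∧ k ≤ Set.ncard {i : Fin n | jointDist p (S i) ≤ ρ}}

/-- The reward grid `{1/m, 2/m, …, (m-1)/m}`. -/
def rewardGrid (m : ℕ) : Set ℝ :=
  {r | ∃ j : ℕ, 1 ≤ j ∧ j < m ∧ r = (j : ℝ) / (m : ℝ)}

/-- `r` is a possible output at context `x`: a minimizer of the `k`-NN radius over the grid,
that is, a maximizer of the `k`-NN density estimate `k / (v_{d+1} n r_k(r, x)^(d+1))`. -/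
def IsModeEstimate {d n : ℕ} (S : Fin n → ℝ × Ctx d) (k m : ℕ) (x : Ctx d) (r : ℝ) : Prop :=
  r ∈ rewardGrid m ∧ ∀ r' ∈ rewardGrid m, knnRadius S k (r, x) ≤ knnRadius S k (r', x)

/-! ### Densities and modes -/

/-- `f` is a probability density on `[0,1] × 𝒳`. -/
def IsJointDensity {d : ℕ} (𝒳 : Set (Ctx d)) (f : ℝ → Ctx d → ℝ) : Prop :=
  (∀ r ∈ Icc (0 : ℝ) 1, ∀ x ∈ 𝒳, 0 ≤ f r x) ∧
    ∫ p in Icc (0 : ℝ) 1 ×ˢ 𝒳, f p.1 p.2 = 1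

/-- The law on `ℝ × ℝ^d` of one sample `(r, X)` with density `f` on `[0,1] × 𝒳`. -/
def jointLaw {d : ℕ} (𝒳 : Set (Ctx d)) (f : ℝ → Ctx d → ℝ) : Measure (ℝ × Ctx d) :=
  (volume.restrict (Icc (0 : ℝ) 1 ×ˢ 𝒳)).withDensity fun p => ENNReal.ofReal (f p.1 p.2)

/-- The conditional density `f(r | X = x) = f(r, x) / f_X(x)`, `f_X(x) = ∫₀¹ f(s, x) ds`. -/
def condDensity {d : ℕ} (f : ℝ → Ctx d → ℝ) (x : Ctx d) (r : ℝ) : ℝ :=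
  f r x / ∫ s in Icc (0 : ℝ) 1, f s x

/-- `r` is a (local) mode of the density `g` on `[0,1]`: a strict local maximum. -/
def IsLocalMode (g : ℝ → ℝ) (r : ℝ) : Prop :=
  r ∈ Icc (0 : ℝ) 1 ∧
    ∃ η : ℝ, 0 < η ∧ ∀ r' ∈ Icc (0 : ℝ) 1, |r' - r| ≤ η → r' ≠ r → g r' < g r

/-- `r` is the mode of the density `g` on `[0,1]`: its unique highest point. -/
def IsTheMode (g : ℝ → ℝ) (r : ℝ) : Prop :=
  r ∈ Icc (0 : ℝ) 1 ∧ ∀ r' ∈ Icc (0 : ℝ) 1, r' ≠ r → g r' < g r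

/-- `M` is a local maximum region of `g` on `[0,1]`: a connected set on which `g` is constant
and around which `g` is strictly smaller. -/
def IsLocalMaxRegion (g : ℝ → ℝ) (M : Set ℝ) : Prop :=
  M ⊆ Icc (0 : ℝ) 1 ∧ IsConnected M ∧
    ∃ c : ℝ, (∀ r ∈ M, g r = c) ∧
      ∃ U : Set ℝ, IsOpen U ∧ M ⊆ U ∧ ∀ r ∈ (U ∩ Icc (0 : ℝ) 1) \ M, g r < c

/-! ### Regularity -/

/-- Regularity of the conditional densities, with all constants explicit. -/
structure ConditionalRegularity {d : ℕ} (𝒳 : Set (Ctx d)) (f : ℝ → Ctx d → ℝ)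
    (α Cα Clow Cup rM lam : ℝ) : Prop where
  /-- joint Hölder continuity on `[0,1] × 𝒳` -/
  holder : ∀ x ∈ 𝒳, ∀ x' ∈ 𝒳, ∀ r ∈ Icc (0 : ℝ) 1, ∀ r' ∈ Icc (0 : ℝ) 1,
    |f r x - f r' x'| ≤ Cα * jointDist (r, x) (r', x') ^ α
  /-- the local maxima of the conditional densities are points -/
  points : ∀ x ∈ 𝒳, ∀ M : Set ℝ, IsLocalMaxRegion (condDensity f x) M → M.Subsingleton
  /-- quadratic decay around the modes, uniformly in the context -/
  quadratic : ∀ x ∈ 𝒳, ∀ r₀ : ℝ, IsLocalMode (condDensity f x) r₀ →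
    ∀ r ∈ Icc (0 : ℝ) 1, |r - r₀| ≤ rM →
      Clow * (r₀ - r) ^ 2 ≤ |f r₀ x - f r x| ∧ |f r₀ x - f r x| ≤ Cup * (r₀ - r) ^ 2
  /-- the joint density is bounded below near the modes, uniformly in the context -/
  lower : ∀ x ∈ 𝒳, ∀ r₀ : ℝ, IsLocalMode (condDensity f x) r₀ →
    ∀ r ∈ Icc (0 : ℝ) 1, |r - r₀| ≤ rM → lam ≤ f r x

/-- `𝒳` has no cusps: balls of radius at most `1` centred in `𝒳` have a fixed proportion of
their volume in `𝒳`. -/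
def IsThick {d : ℕ} (𝒳 : Set (Ctx d)) (c : ℝ) : Prop :=
  ∀ x ∈ 𝒳, ∀ ρ : ℝ, 0 < ρ → ρ ≤ 1 →
    ENNReal.ofReal (c * ρ ^ d) ≤ volume (Metric.closedBall x ρ ∩ 𝒳)

/-- `B` bounds the density `f`. -/
def IsSupBound {d : ℕ} (𝒳 : Set (Ctx d)) (f : ℝ → Ctx d → ℝ) (B : ℝ) : Prop :=
  ∀ x ∈ 𝒳, ∀ r ∈ Icc (0 : ℝ) 1, f r x ≤ B

/-- `γ` is a gap between the value of `f(·, x)` at its highest point `mode x` and its values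
at distance at least `rM` from there, for every context `x`. -/
def IsModeGap {d : ℕ} (𝒳 : Set (Ctx d)) (f : ℝ → Ctx d → ℝ) (mode : Ctx d → ℝ)
    (rM γ : ℝ) : Prop :=
  ∀ x ∈ 𝒳, ∀ r ∈ Icc (0 : ℝ) 1, rM ≤ |r - mode x| → f r x + γ ≤ f (mode x) x

end CondMode

end

/-!
The estimator compares, at one context `x`, the radii of the balls around the grid points `(r, x)`
that hold `k` of the `n` sample points. The context space `𝒳` may have an irregular boundary, but
two balls with the same context and the same radius `ρ` are cut by `𝒳` in sets of the same volume
`sliceVol 𝒳 x ρ`. Their masses therefore compare as the values of the density at their centres, up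
to the Hölder oscillation `O(ρ ^ α)`. Only the ends of `[0,1]` can spoil this, and they only
decrease masses. Near the mode a grid point is chosen whose ball stays inside `[0,1]`; by the
quadratic upper bound this costs `O((ρ + 1 / m) ^ 2)`.

Fix a context `y`, and choose `ρ` so that the ball near the mode has mass slightly above `k / n`
(`exists_radius`). Such a `ρ` is of order `s = n ^ (-1 / (2 α + d + 1))`, since `𝒳` is thick and the
density is at least `lam` near the mode. If the density at `(r, y)` is smaller than at the mode by a
large multiple of `τ = s ^ α log n`, then even a slightly larger ball around `(r, y)` has mass
clearly below `k / n`. As `k τ ^ 2` is of order `(log n) ^ 2`, Chernoff bounds (`pi_le_count_le`,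
`pi_count_lt_le`) show that the sample reproduces both inequalities
(`exists_radius_and_gridPoint`).

Uniformity in `x` comes from a net of `𝒳` of mesh `η = s ^ 2`: enlarging the radii by multiples of
`η` changes the volumes by a relative error `O(s)`, the volume of a spherical shell, and absorbs the
passage from `x` to the nearest net point (`knnRadius_lt_knnRadius`). The net has polynomially
many points, with constants not depending on `𝒳`: the lower bound on the density near the modes
bounds the volume of `𝒳` (`volume_contexts_le`), and thickness then bounds the cardinality of
separated sets (`exists_net`). So the union bound (`pi_exists_far_le`) succeeds for large `n`.

Finally, by the quadratic lower bound and the gap `γ`, a reward at distance at least `ε` from the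
mode loses at least `min γ (Clow ε ^ 2)`. For `ε` of order `s ^ (α / 2) log n` this exceeds every
multiple of `τ` once `n` is large, by one factor `log n`, whatever the constant `C₀`.
-/

noncomputable section

namespace CondMode

variable {d : ℕ}

/-! ### Euclidean balls in the space of reward-context pairs -/

lemma jointDist_eq_dist (p q : ℝ × Ctx d) :
    jointDist p q = dist (WithLp.toLp 2 p) (WithLp.toLp 2 q) := by
  rw [jointDist, WithLp.prod_dist_eq_of_L2]
  simp [dist_eq_norm, sq_abs]

lemma jointDist_nonneg (p q : ℝ × Ctx d) : 0 ≤ jointDist p q := Real.sqrt_nonneg _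

lemma jointDist_triangle (p q s : ℝ × Ctx d) :
    jointDist p s ≤ jointDist p q + jointDist q s := by
  simp only [jointDist_eq_dist]
  exact dist_triangle _ _ _

lemma abs_fst_sub_le_jointDist (p q : ℝ × Ctx d) : |p.1 - q.1| ≤ jointDist p q :=
  Real.abs_le_sqrt (by nlinarith [sq_nonneg ‖p.2 - q.2‖])

lemma jointDist_same_fst (r : ℝ) (x y : Ctx d) : jointDist (r, x) (r, y) = ‖x - y‖ := by
  simp [jointDist, Real.sqrt_sq]

lemma continuous_jointDist : Continuous fun z : (ℝ × Ctx d) × (ℝ × Ctx d) =>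
    jointDist z.1 z.2 := by
  unfold jointDist
  fun_prop

/-- The closed Euclidean ball of radius `ρ` around `p` in `ℝ^(d+1)`. -/
def jointBall (p : ℝ × Ctx d) (ρ : ℝ) : Set (ℝ × Ctx d) := {q | jointDist p q ≤ ρ}

lemma isClosed_jointBall (p : ℝ × Ctx d) (ρ : ℝ) : IsClosed (jointBall p ρ) :=
  isClosed_le (continuous_jointDist.comp (by fun_prop : Continuous fun q => (p, q)))
    continuous_const

lemma measurableSet_jointBall (p : ℝ × Ctx d) (ρ : ℝ) : MeasurableSet (jointBall p ρ) :=
  (isClosed_jointBall p ρ).measurableSet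

lemma jointBall_mono (p : ℝ × Ctx d) {ρ ρ' : ℝ} (h : ρ ≤ ρ') :
    jointBall p ρ ⊆ jointBall p ρ' := fun _ hq => le_trans hq h

lemma jointBall_subset_closedBall (p : ℝ × Ctx d) (ρ : ℝ) :
    jointBall p ρ ⊆ Metric.closedBall p ρ := by
  intro q hq
  rw [Metric.mem_closedBall, dist_comm, Prod.dist_eq]
  refine max_le ((abs_fst_sub_le_jointDist p q).trans hq) ?_
  rw [dist_eq_norm]
  refine le_trans (Real.le_sqrt_of_sq_le ?_) hq
  nlinarith [sq_nonneg (p.1 - q.1)]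

lemma volume_jointBall_lt_top (p : ℝ × Ctx d) (ρ : ℝ) : volume (jointBall p ρ) < ⊤ :=
  (measure_mono (jointBall_subset_closedBall p ρ)).trans_lt
    (isCompact_closedBall p ρ).measure_lt_top

instance isAddHaarMeasure_volume_joint :
    (volume : Measure (ℝ × Ctx d)).IsAddHaarMeasure := by
  rw [Measure.volume_eq_prod]
  infer_instance

/-- The volume of the Euclidean unit ball of `ℝ^(d+1)`. -/
def unitVol (d : ℕ) : ℝ := volume.real (jointBall (0 : ℝ × Ctx d) 1)

lemma unitVol_nonneg (d : ℕ) : 0 ≤ unitVol d := measureReal_nonneg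

lemma volume_real_jointBall (p : ℝ × Ctx d) {ρ : ℝ} (hρ : 0 < ρ) :
    volume.real (jointBall p ρ) = unitVol d * ρ ^ (d + 1) := by
  have h1 : volume (jointBall p ρ) = volume (jointBall (0 : ℝ × Ctx d) ρ) := by
    rw [← measure_preimage_add volume p (jointBall p ρ)]
    congr 1
    ext q
    simp [jointBall, jointDist]
  have h2 : jointBall (0 : ℝ × Ctx d) ρ = (ρ⁻¹ • ·) ⁻¹' jointBall (0 : ℝ × Ctx d) 1 := by
    ext q
    have : jointDist 0 (ρ⁻¹ • q) = ρ⁻¹ * jointDist 0 q := by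
      simp only [jointDist_eq_dist, WithLp.toLp_smul, WithLp.toLp_zero, dist_zero_left,
        norm_smul, Real.norm_eq_abs, abs_of_pos (inv_pos.2 hρ)]
    simp only [jointBall, mem_preimage, mem_ofPred_eq, this]
    rw [inv_mul_le_iff₀ hρ, mul_one]
  rw [measureReal_def, h1, h2, Measure.addHaar_preimage_smul _ (inv_pos.2 hρ).ne',
    ENNReal.toReal_mul, mul_comm, unitVol, measureReal_def]
  congr 1
  rw [ENNReal.toReal_ofReal (abs_nonneg _), abs_of_pos (by positivity)]
  simp [add_comm]

/-! ### Balls cut by the context space -/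

/-- The volume of the part of the Euclidean ball of radius `ρ` around `(0, x)` whose contexts lie
in `𝒳`. The rewards are not restricted to `[0,1]`, so this is also the volume for the centre
`(r, x)`, whatever `r` is. -/
def sliceVol (𝒳 : Set (Ctx d)) (x : Ctx d) (ρ : ℝ) : ℝ :=
  volume.real (jointBall ((0 : ℝ), x) ρ ∩ univ ×ˢ 𝒳)

lemma volume_jointBall_inter (𝒳 : Set (Ctx d)) (r : ℝ) (x : Ctx d) (ρ : ℝ) :
    volume (jointBall (r, x) ρ ∩ univ ×ˢ 𝒳) = ENNReal.ofReal (sliceVol 𝒳 x ρ) := by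
  rw [sliceVol, measureReal_def, ENNReal.ofReal_toReal
    ((measure_mono inter_subset_left).trans_lt (volume_jointBall_lt_top _ _)).ne,
    ← measure_preimage_add volume ((r, 0) : ℝ × Ctx d) (jointBall (r, x) ρ ∩ univ ×ˢ 𝒳)]
  congr 1
  ext q
  simp [jointBall, jointDist]

lemma sliceVol_nonneg (𝒳 : Set (Ctx d)) (x : Ctx d) (ρ : ℝ) : 0 ≤ sliceVol 𝒳 x ρ :=
  measureReal_nonneg

lemma sliceVol_mono (𝒳 : Set (Ctx d)) (x : Ctx d) {ρ ρ' : ℝ} (h : ρ ≤ ρ') :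
    sliceVol 𝒳 x ρ ≤ sliceVol 𝒳 x ρ' :=
  measureReal_mono (inter_subset_inter_left _ (jointBall_mono _ h))
    ((measure_mono inter_subset_left).trans_lt (volume_jointBall_lt_top _ _)).ne

lemma sliceVol_le (𝒳 : Set (Ctx d)) (x : Ctx d) {ρ : ℝ} (hρ : 0 < ρ) :
    sliceVol 𝒳 x ρ ≤ unitVol d * ρ ^ (d + 1) := by
  rw [← volume_real_jointBall ((0 : ℝ), x) hρ]
  exact measureReal_mono inter_subset_left (volume_jointBall_lt_top _ _).ne

/-- Increasing the radius adds at most the volume of a full spherical shell. -/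
lemma sliceVol_le_add_shell {𝒳 : Set (Ctx d)} (x : Ctx d) {a b : ℝ}
    (ha : 0 < a) (hab : a ≤ b) :
    sliceVol 𝒳 x b ≤ sliceVol 𝒳 x a + unitVol d * ((d + 1) * (b - a) * b ^ d) := by
  have hb : 0 < b := ha.trans_le hab
  have h1 : sliceVol 𝒳 x b ≤ sliceVol 𝒳 x a +
      volume.real (jointBall ((0 : ℝ), x) b \ jointBall ((0 : ℝ), x) a) := by
    refine (measureReal_mono (?_ : _ ⊆ (jointBall ((0 : ℝ), x) a ∩ univ ×ˢ 𝒳) ∪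
      (jointBall ((0 : ℝ), x) b \ jointBall ((0 : ℝ), x) a)) ?_).trans
      (measureReal_union_le _ _)
    · intro q hq
      by_cases h : q ∈ jointBall ((0 : ℝ), x) a
      · exact Or.inl ⟨h, hq.2⟩
      · exact Or.inr ⟨hq.1, h⟩
    · refine ((measure_mono (?_ : _ ⊆ jointBall ((0 : ℝ), x) b)).trans_lt
        (volume_jointBall_lt_top _ _)).ne
      rintro q (hq | hq)
      · exact jointBall_mono _ hab hq.1
      · exact hq.1
  have h2 : volume.real (jointBall ((0 : ℝ), x) b \ jointBall ((0 : ℝ), x) a) =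
      unitVol d * (b ^ (d + 1) - a ^ (d + 1)) := by
    rw [measureReal_sdiff (jointBall_mono _ hab) (measurableSet_jointBall _ _)
      (volume_jointBall_lt_top _ _).ne, volume_real_jointBall _ hb, volume_real_jointBall _ ha]
    ring
  have h3 : b ^ (d + 1) - a ^ (d + 1) ≤ (d + 1) * (b - a) * b ^ d := by
    have h4 := one_add_mul_sub_le_pow (a := a / b) (by linarith [div_pos ha hb]) (d + 1)
    rw [div_pow, le_div_iff₀ (by positivity)] at h4
    have h5 : (1 + ((d + 1 : ℕ) : ℝ) * (a / b - 1)) * b ^ (d + 1)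
        = b ^ (d + 1) - (d + 1) * (b - a) * b ^ d := by
      push_cast
      field_simp
      ring
    linarith
  rw [h2] at h1
  nlinarith [mul_le_mul_of_nonneg_left h3 (unitVol_nonneg d)]

/-- Thickness of `𝒳` gives a lower bound: the ball contains the product of a segment of length
`ρ` with the ball of radius `ρ / 2` in the contexts. -/
lemma le_sliceVol {𝒳 : Set (Ctx d)} {c : ℝ} (hth : IsThick 𝒳 c)
    {x : Ctx d} (hx : x ∈ 𝒳) {ρ : ℝ} (hρ : 0 < ρ) (hρ1 : ρ ≤ 1) :
    c * (ρ / 2) ^ d * ρ ≤ sliceVol 𝒳 x ρ := by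
  have h1 : Icc (-(ρ / 2)) (ρ / 2) ×ˢ (Metric.closedBall x (ρ / 2) ∩ 𝒳) ⊆
      jointBall ((0 : ℝ), x) ρ ∩ univ ×ˢ 𝒳 := by
    rintro ⟨r, y⟩ ⟨hr, hy, hy'⟩
    refine ⟨?_, mem_univ _, hy'⟩
    simp only [mem_Icc, Metric.mem_closedBall, dist_comm y x, dist_eq_norm] at hr hy
    refine Real.sqrt_le_iff.2 ⟨hρ.le, ?_⟩
    have := norm_nonneg (x - y)
    simp only
    nlinarith [abs_le.2 hr]
  have h2 := measure_mono (μ := volume) h1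
  rw [volume_jointBall_inter, Measure.volume_eq_prod, Measure.prod_prod, Real.volume_Icc] at h2
  have h3 := hth x hx (ρ / 2) (by positivity) (by linarith)
  rw [← ENNReal.ofReal_le_ofReal_iff (sliceVol_nonneg _ _ _)]
  refine le_trans ?_ h2
  rw [mul_comm, ENNReal.ofReal_mul hρ.le]
  gcongr
  linarith

/-- There is a radius at which the volume of the cut ball reaches `v` and has not grown much
beyond `v` a little further out. Only monotonicity is used, not continuity of the volume. -/
lemma exists_radius {𝒳 : Set (Ctx d)} (x : Ctx d) {v η R : ℝ}
    (hη : 0 < η) (hsmall : unitVol d * η ^ (d + 1) < v) (hR : v ≤ sliceVol 𝒳 x R) :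
    ∃ ρ, η < ρ ∧ ρ < R + η ∧ v ≤ sliceVol 𝒳 x ρ ∧
      sliceVol 𝒳 x (ρ + 3 * η) ≤ v + unitVol d * ((d + 1) * (4 * η) * (ρ + 3 * η) ^ d) := by
  have key : ∀ ρ, v ≤ sliceVol 𝒳 x ρ → η < ρ := by
    intro ρ h
    by_contra! hle
    linarith [sliceVol_mono 𝒳 x hle, sliceVol_le 𝒳 x hη]
  have hbdd : BddBelow {ρ | v ≤ sliceVol 𝒳 x ρ} := ⟨η, fun ρ h => (key ρ h).le⟩
  obtain ⟨ρ, hρ, hlt⟩ := exists_lt_of_csInf_lt (⟨R, hR⟩ : {ρ | v ≤ sliceVol 𝒳 x ρ}.Nonempty)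
    (lt_add_of_pos_right (sInf {ρ | v ≤ sliceVol 𝒳 x ρ}) hη)
  refine ⟨ρ, key ρ hρ, ?_, hρ, ?_⟩
  · linarith [csInf_le hbdd hR]
  · have h1 : sliceVol 𝒳 x (ρ - η) < v := by
      by_contra! h
      linarith [csInf_le hbdd h]
    have h2 := sliceVol_le_add_shell (𝒳 := 𝒳) x (a := ρ - η) (b := ρ + 3 * η)
      (by linarith [key ρ hρ]) (by linarith)
    have h3 : ρ + 3 * η - (ρ - η) = 4 * η := by ring
    rw [h3] at h2
    linarith

/-! ### The mass of a ball -/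

lemma jointLaw_apply {𝒳 : Set (Ctx d)} (f : ℝ → Ctx d → ℝ) {A : Set (ℝ × Ctx d)}
    (hA : MeasurableSet A) :
    jointLaw 𝒳 f A = ∫⁻ p in A ∩ Icc (0 : ℝ) 1 ×ˢ 𝒳, ENNReal.ofReal (f p.1 p.2) := by
  rw [jointLaw, withDensity_apply _ hA, Measure.restrict_restrict hA]

lemma jointLaw_jointBall_le {𝒳 : Set (Ctx d)} (h𝒳 : MeasurableSet 𝒳) {f : ℝ → Ctx d → ℝ}
    {r : ℝ} {x : Ctx d} {ρ b : ℝ} (hb0 : 0 ≤ b)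
    (hb : ∀ q ∈ jointBall (r, x) ρ ∩ Icc (0 : ℝ) 1 ×ˢ 𝒳, f q.1 q.2 ≤ b) :
    jointLaw 𝒳 f (jointBall (r, x) ρ) ≤ ENNReal.ofReal (b * sliceVol 𝒳 x ρ) := by
  rw [jointLaw_apply f (measurableSet_jointBall _ _), ENNReal.ofReal_mul hb0,
    ← volume_jointBall_inter 𝒳 r x ρ]
  refine (setLIntegral_mono' (g := fun _ => ENNReal.ofReal b)
    ((measurableSet_jointBall _ _).inter (measurableSet_Icc.prod h𝒳))
    fun q hq => ENNReal.ofReal_le_ofReal (hb q hq)).trans ?_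
  rw [setLIntegral_const]
  gcongr
  exact subset_univ _

lemma le_jointLaw_jointBall {𝒳 : Set (Ctx d)} (h𝒳 : MeasurableSet 𝒳) {f : ℝ → Ctx d → ℝ}
    {r : ℝ} {x : Ctx d} {ρ a : ℝ} (ha0 : 0 ≤ a) (h0 : 0 ≤ r - ρ) (h1 : r + ρ ≤ 1)
    (ha : ∀ q ∈ jointBall (r, x) ρ ∩ Icc (0 : ℝ) 1 ×ˢ 𝒳, a ≤ f q.1 q.2) :
    ENNReal.ofReal (a * sliceVol 𝒳 x ρ) ≤ jointLaw 𝒳 f (jointBall (r, x) ρ) := by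
  have hsub : jointBall (r, x) ρ ∩ univ ×ˢ 𝒳 ⊆ jointBall (r, x) ρ ∩ Icc (0 : ℝ) 1 ×ˢ 𝒳 := by
    rintro q ⟨hq, -, hq'⟩
    have := abs_le.1 ((abs_fst_sub_le_jointDist _ _).trans hq)
    simp only at this
    exact ⟨hq, ⟨by linarith, by linarith⟩, hq'⟩
  rw [jointLaw_apply f (measurableSet_jointBall _ _), ENNReal.ofReal_mul ha0,
    ← volume_jointBall_inter 𝒳 r x ρ]
  refine le_trans ?_ (setLIntegral_mono' (f := fun _ => ENNReal.ofReal a)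
    ((measurableSet_jointBall _ _).inter (measurableSet_Icc.prod h𝒳))
    fun q hq => ENNReal.ofReal_le_ofReal (ha q hq))
  rw [setLIntegral_const]
  gcongr

/-! ### Concentration of the number of sample points in a set -/

section Chernoff

variable {E : Type*} [MeasurableSpace E]

/-- Exponential Markov inequality for the number of sample points in `A`. -/
lemma pi_count_le (μ : Measure E) [IsProbabilityMeasure μ] {A : Set E} (hA : MeasurableSet A)
    (n : ℕ) (t u : ℝ) :
    Measure.pi (fun _ : Fin n => μ) {S | u ≤ t * ({i | S i ∈ A}.ncard : ℝ)} ≤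
      ENNReal.ofReal (Real.exp (n * (μ.real A * (Real.exp t - 1)) - u)) := by
  classical
  set g : E → ℝ := fun y => Real.exp (t * A.indicator 1 y) with hg
  have hgval : g = fun y => 1 + A.indicator (fun _ => Real.exp t - 1) y := by
    funext y
    by_cases hy : y ∈ A <;> simp [hg, hy]
  have hgint : ∫ y, g y ∂μ = 1 + μ.real A * (Real.exp t - 1) := by
    rw [hgval, integral_add (integrable_const _) ((integrable_const _).indicator hA),
      integral_indicator hA]
    simp
  have hgi : Integrable g μ := by
    rw [hgval]
    exact (integrable_const _).add ((integrable_const _).indicator hA)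
  have hprod : ∀ S : Fin n → E, ∏ i, g (S i) = Real.exp (t * ({i | S i ∈ A}.ncard : ℝ)) := by
    intro S
    rw [← Real.exp_sum, ← Finset.mul_sum]
    congr 2
    rw [Set.ncard_eq_toFinset_card']
    simp [Set.indicator_apply]
  have hint : Integrable (fun S : Fin n → E => ∏ i, g (S i)) (Measure.pi fun _ => μ) :=
    Integrable.fintype_prod fun _ => hgi
  have hmarkov := mul_meas_ge_le_integral_of_nonneg
    (Filter.Eventually.of_forall fun S : Fin n → E =>
      Finset.prod_nonneg fun i _ => (Real.exp_pos _).le) hint (Real.exp u)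
  replace hmarkov := hmarkov.trans_eq (integral_fintype_prod_eq_pow (𝕜 := ℝ) g)
  rw [hgint, Fintype.card_fin] at hmarkov
  have hset : {S : Fin n → E | u ≤ t * ({i | S i ∈ A}.ncard : ℝ)} =
      {S | Real.exp u ≤ ∏ i, g (S i)} := by
    ext S
    simp only [mem_ofPred_eq, hprod, Real.exp_le_exp]
  rw [hset, ← ENNReal.ofReal_toReal (measure_ne_top (Measure.pi fun _ : Fin n => μ) _)]
  refine ENNReal.ofReal_le_ofReal ?_
  rw [← measureReal_def, Real.exp_sub, le_div_iff₀ (Real.exp_pos _), mul_comm]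
  refine hmarkov.trans ?_
  rw [Real.exp_nat_mul]
  have hp1 : μ.real A ≤ 1 := measureReal_le_one
  refine pow_le_pow_left₀ ?_ (by linarith [Real.add_one_le_exp (μ.real A * (Real.exp t - 1))]) n
  nlinarith [Real.exp_pos t, measureReal_nonneg (μ := μ) (s := A)]

/-- Chernoff bound: at least `k` sample points in a set of mass at most `(1 - τ) k / n`. -/
lemma pi_le_count_le (μ : Measure E) [IsProbabilityMeasure μ] {A : Set E}
    (hA : MeasurableSet A) (n k : ℕ) {τ : ℝ} (hτ : 0 < τ) (hτ1 : τ ≤ 1 / 2)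
    (hp : n * μ.real A ≤ (1 - τ) * k) :
    Measure.pi (fun _ : Fin n => μ) {S | k ≤ {i | S i ∈ A}.ncard} ≤
      ENNReal.ofReal (Real.exp (-(k * τ ^ 2 / 8))) := by
  have h := pi_count_le μ hA n (τ / 2) (τ / 2 * k)
  refine (measure_mono ?_).trans (h.trans (ENNReal.ofReal_le_ofReal (Real.exp_le_exp.2 ?_)))
  · intro S hS
    have : (k : ℝ) ≤ ({i | S i ∈ A}.ncard : ℝ) := by exact_mod_cast hS
    simp only [mem_ofPred_eq]
    gcongr
  · have he := (abs_le.1 (Real.abs_exp_sub_one_sub_id_le (x := τ / 2)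
      (by rw [abs_of_pos] <;> linarith))).2
    have hk : (0 : ℝ) ≤ k := Nat.cast_nonneg k
    have h0 : (0 : ℝ) ≤ n * μ.real A := by positivity
    have h1 : n * (μ.real A * (Real.exp (τ / 2) - 1)) ≤
        ((1 - τ) * k) * (τ / 2 + (τ / 2) ^ 2) := by
      rw [← mul_assoc]
      have : 0 ≤ Real.exp (τ / 2) - 1 := by linarith [Real.add_one_le_exp (τ / 2)]
      exact mul_le_mul hp (by linarith) this (h0.trans hp)
    have h2 : (0 : ℝ) ≤ k * τ ^ 2 := by positivity
    nlinarith [mul_nonneg h2 hτ.le]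

/-- Chernoff bound: fewer than `k` sample points in a set of mass at least `(1 + τ) k / n`. -/
lemma pi_count_lt_le (μ : Measure E) [IsProbabilityMeasure μ] {A : Set E}
    (hA : MeasurableSet A) (n k : ℕ) {τ : ℝ} (hτ : 0 < τ) (hτ1 : τ ≤ 1 / 2)
    (hp : (1 + τ) * k ≤ n * μ.real A) :
    Measure.pi (fun _ : Fin n => μ) {S | {i | S i ∈ A}.ncard < k} ≤
      ENNReal.ofReal (Real.exp (-(k * τ ^ 2 / 8))) := by
  have h := pi_count_le μ hA n (-(τ / 2)) (-(τ / 2) * k)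
  refine (measure_mono ?_).trans (h.trans (ENNReal.ofReal_le_ofReal (Real.exp_le_exp.2 ?_)))
  · intro S hS
    have : ({i | S i ∈ A}.ncard : ℝ) ≤ (k : ℝ) := by exact_mod_cast (le_of_lt hS)
    simp only [mem_ofPred_eq]
    nlinarith
  · have he := (abs_le.1 (Real.abs_exp_sub_one_sub_id_le (x := -(τ / 2))
      (by rw [abs_neg, abs_of_pos] <;> linarith))).2
    have hk : (0 : ℝ) ≤ k := Nat.cast_nonneg k
    have h0 : (0 : ℝ) ≤ n * μ.real A := by positivity
    have h1 : n * (μ.real A * (Real.exp (-(τ / 2)) - 1)) ≤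
        ((1 + τ) * k) * (-(τ / 2) + (τ / 2) ^ 2) := by
      rw [← mul_assoc]
      have h3 : n * μ.real A * (Real.exp (-(τ / 2)) - 1) ≤
          n * μ.real A * (-(τ / 2) + (τ / 2) ^ 2) := by
        gcongr
        linarith
      have h4 : -(τ / 2) + (τ / 2) ^ 2 ≤ 0 := by nlinarith
      exact h3.trans (mul_le_mul_of_nonpos_right hp h4)
    have h2 : (0 : ℝ) ≤ k * τ ^ 2 := by positivity
    nlinarith [mul_le_mul_of_nonneg_left hτ1 h2]

end Chernoff

/-! ### Consequences of the regularity of the density -/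

lemma IsTheMode.isLocalMode {g : ℝ → ℝ} {r : ℝ} (h : IsTheMode g r) : IsLocalMode g r :=
  ⟨h.1, 1, one_pos, fun r' hr' _ hne => h.2 r' hr' hne⟩

/-- Dividing by the marginal density does not move the mode; the marginal density is positive
because a vanishing conditional density has no strict maximum. -/
lemma IsTheMode.of_condDensity {𝒳 : Set (Ctx d)} {f : ℝ → Ctx d → ℝ} (hf : IsJointDensity 𝒳 f)
    {x : Ctx d} (hx : x ∈ 𝒳) {r : ℝ} (h : IsTheMode (condDensity f x) r) :
    IsTheMode (fun s => f s x) r := by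
  have h0 : 0 ≤ ∫ s in Icc (0 : ℝ) 1, f s x :=
    setIntegral_nonneg measurableSet_Icc fun s hs => hf.1 s hs x hx
  refine ⟨h.1, fun r' hr' hne => ?_⟩
  have hlt := h.2 r' hr' hne
  unfold condDensity at hlt
  have hne0 : (∫ s in Icc (0 : ℝ) 1, f s x) ≠ 0 := by
    intro h'
    simp [h'] at hlt
  exact (div_lt_div_iff_of_pos_right (lt_of_le_of_ne h0 hne0.symm)).1 hlt

lemma continuousOn_of_holder {𝒳 : Set (Ctx d)} {f : ℝ → Ctx d → ℝ} {α Cα : ℝ} (hα : 0 < α)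
    (h : ∀ x ∈ 𝒳, ∀ x' ∈ 𝒳, ∀ r ∈ Icc (0 : ℝ) 1, ∀ r' ∈ Icc (0 : ℝ) 1,
      |f r x - f r' x'| ≤ Cα * jointDist (r, x) (r', x') ^ α) :
    ContinuousOn (fun p : ℝ × Ctx d => f p.1 p.2) (Icc (0 : ℝ) 1 ×ˢ 𝒳) := by
  intro p hp
  rw [ContinuousWithinAt, tendsto_iff_dist_tendsto_zero]
  have hc : Continuous fun q : ℝ × Ctx d => Cα * jointDist q p ^ α :=
    continuous_const.mul ((continuous_jointDist.comp
      (by fun_prop : Continuous fun q : ℝ × Ctx d => (q, p))).rpow_const fun _ => Or.inr hα.le)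
  have h0 : Filter.Tendsto (fun q : ℝ × Ctx d => Cα * jointDist q p ^ α)
      (nhdsWithin p (Icc (0 : ℝ) 1 ×ˢ 𝒳)) (nhds 0) := by
    have := (hc.tendsto p).mono_left (nhdsWithin_le_nhds (s := Icc (0 : ℝ) 1 ×ˢ 𝒳))
    simpa [jointDist, Real.zero_rpow hα.ne'] using this
  refine squeeze_zero' (Filter.Eventually.of_forall fun _ => dist_nonneg) ?_ h0
  filter_upwards [self_mem_nhdsWithin] with q hq
  exact h _ hq.2 _ hp.2 _ hq.1 _ hp.1

lemma exists_isSupBound {𝒳 : Set (Ctx d)} {f : ℝ → Ctx d → ℝ} (h𝒳 : IsCompact 𝒳)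
    (hf : ContinuousOn (fun p : ℝ × Ctx d => f p.1 p.2) (Icc (0 : ℝ) 1 ×ˢ 𝒳)) :
    ∃ B, IsSupBound 𝒳 f B := by
  obtain ⟨B, hB⟩ := (isCompact_Icc.prod h𝒳).bddAbove_image hf
  exact ⟨B, fun x hx r hr => hB ⟨(r, x), ⟨hr, hx⟩, rfl⟩⟩

/-- The gap is the minimum of `f s x - f r x` over the triples `(s, r, x)` where `s` maximizes
`f · x` and `|r - s| ≥ rM`. They form a compact set, since maximizing is a closed condition. -/
lemma exists_isModeGap {𝒳 : Set (Ctx d)} {f : ℝ → Ctx d → ℝ} {mode : Ctx d → ℝ} {rM : ℝ}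
    (h𝒳 : IsCompact 𝒳) (hrM : 0 < rM)
    (hf : ContinuousOn (fun p : ℝ × Ctx d => f p.1 p.2) (Icc (0 : ℝ) 1 ×ˢ 𝒳))
    (hmode : ∀ x ∈ 𝒳, IsTheMode (fun s => f s x) (mode x)) :
    ∃ γ, 0 < γ ∧ IsModeGap 𝒳 f mode rM γ := by
  set K₀ : Set (ℝ × ℝ × Ctx d) :=
    (Icc (0 : ℝ) 1 ×ˢ Icc (0 : ℝ) 1 ×ˢ 𝒳) ∩ {z | rM ≤ |z.2.1 - z.1|} with hK₀
  have hK₀c : IsCompact K₀ := (isCompact_Icc.prod (isCompact_Icc.prod h𝒳)).inter_right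
    (isClosed_le (by fun_prop) (by fun_prop))
  have hcs : ContinuousOn (fun z : ℝ × ℝ × Ctx d => f z.1 z.2.2) K₀ :=
    hf.comp (f := fun z : ℝ × ℝ × Ctx d => (z.1, z.2.2)) (by fun_prop)
      fun z hz => ⟨hz.1.1, hz.1.2.2⟩
  have hcr : ContinuousOn (fun z : ℝ × ℝ × Ctx d => f z.2.1 z.2.2) K₀ :=
    hf.comp (f := fun z : ℝ × ℝ × Ctx d => z.2) (by fun_prop) fun z hz => hz.1.2
  set K : Set (ℝ × ℝ × Ctx d) :=
    ⋂ t ∈ Icc (0 : ℝ) 1, {z ∈ K₀ | f t z.2.2 ≤ f z.1 z.2.2} with hK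
  have hKmem : ∀ z, z ∈ K ↔ z ∈ K₀ ∧ ∀ t ∈ Icc (0 : ℝ) 1, f t z.2.2 ≤ f z.1 z.2.2 := by
    intro z
    simp only [hK, mem_iInter, mem_ofPred_eq]
    exact ⟨fun h => ⟨(h 0 (by simp)).1, fun t ht => (h t ht).2⟩,
      fun h t ht => ⟨h.1, h.2 t ht⟩⟩
  have hKc : IsCompact K := by
    refine hK₀c.of_isClosed_subset (isClosed_biInter fun t ht =>
      hK₀c.isClosed.isClosed_le ?_ hcs) fun z hz => ((hKmem z).1 hz).1
    exact hf.comp (f := fun z : ℝ × ℝ × Ctx d => (t, z.2.2)) (by fun_prop)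
      fun z hz => ⟨ht, hz.1.2.2⟩
  have hin : ∀ x ∈ 𝒳, ∀ r ∈ Icc (0 : ℝ) 1, rM ≤ |r - mode x| → (mode x, r, x) ∈ K := by
    intro x hx r hr hd
    refine (hKmem _).2 ⟨⟨⟨(hmode x hx).1, hr, hx⟩, hd⟩, fun t ht => ?_⟩
    by_cases h : t = mode x
    · rw [h]
    · exact ((hmode x hx).2 t ht h).le
  rcases K.eq_empty_or_nonempty with hE | hne
  · refine ⟨1, one_pos, fun x hx r hr hd => ?_⟩
    have := hin x hx r hr hd
    simp [hE] at this
  · obtain ⟨z, hz, hmin⟩ := hKc.exists_isMinOn hne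
      ((hcs.sub hcr).mono fun z hz => ((hKmem z).1 hz).1)
    obtain ⟨⟨⟨hz1, hz2, hz3⟩, hzd⟩, hzmax⟩ := (hKmem z).1 hz
    refine ⟨f z.1 z.2.2 - f z.2.1 z.2.2, ?_, fun x hx r hr hd => ?_⟩
    · have hm := hmode _ hz3
      have hz1' : z.1 = mode z.2.2 := by
        by_contra h
        exact absurd (hm.2 _ hz1 h) (not_lt.2 (hzmax _ hm.1))
      have hz2' : z.2.1 ≠ mode z.2.2 := by
        intro h
        simp only [mem_ofPred_eq, h, hz1', sub_self, abs_zero] at hzd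
        linarith
      rw [sub_pos, hz1']
      exact hm.2 _ hz2 hz2'
    · have := hmin (hin x hx r hr hd)
      simp only [mem_ofPred_eq, Pi.sub_apply] at this
      linarith

lemma lintegral_density {𝒳 : Set (Ctx d)} {f : ℝ → Ctx d → ℝ} (h𝒳 : MeasurableSet 𝒳)
    (hf : IsJointDensity 𝒳 f) :
    ∫⁻ p in Icc (0 : ℝ) 1 ×ˢ 𝒳, ENNReal.ofReal (f p.1 p.2) = 1 := by
  have hi : IntegrableOn (fun p : ℝ × Ctx d => f p.1 p.2) (Icc (0 : ℝ) 1 ×ˢ 𝒳) := by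
    by_contra h
    have := hf.2
    rw [integral_undef h] at this
    exact zero_ne_one this
  rw [← ofReal_integral_eq_lintegral_ofReal hi, hf.2, ENNReal.ofReal_one]
  filter_upwards [ae_restrict_mem (measurableSet_Icc.prod h𝒳)] with p hp
  exact hf.1 _ hp.1 _ hp.2

lemma isProbabilityMeasure_jointLaw {𝒳 : Set (Ctx d)} {f : ℝ → Ctx d → ℝ}
    (h𝒳 : MeasurableSet 𝒳) (hf : IsJointDensity 𝒳 f) :
    IsProbabilityMeasure (jointLaw 𝒳 f) :=
  ⟨by rw [jointLaw_apply f MeasurableSet.univ, univ_inter, lintegral_density h𝒳 hf]⟩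

/-- Around each mode the density is at least `lam` on a segment of fixed length, so the total mass
`1` bounds the volume of the context space. -/
lemma volume_contexts_le {𝒳 : Set (Ctx d)} {f : ℝ → Ctx d → ℝ} {mode : Ctx d → ℝ} {rM lam : ℝ}
    (h𝒳 : MeasurableSet 𝒳) (hf : IsJointDensity 𝒳 f) (hrM : 0 < rM) (hlam : 0 < lam)
    (hfc : ContinuousOn (fun p : ℝ × Ctx d => f p.1 p.2) (Icc (0 : ℝ) 1 ×ˢ 𝒳))
    (hmode : ∀ x ∈ 𝒳, mode x ∈ Icc (0 : ℝ) 1)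
    (hlow : ∀ x ∈ 𝒳, ∀ r ∈ Icc (0 : ℝ) 1, |r - mode x| ≤ rM → lam ≤ f r x) :
    volume 𝒳 ≤ ENNReal.ofReal (1 / (lam * min rM (1 / 2))) := by
  set ℓ := min rM (1 / 2)
  have hℓ0 : 0 < ℓ := lt_min hrM (by norm_num)
  have hℓ1 : ℓ ≤ rM := min_le_left _ _
  have hℓ2 : ℓ ≤ 1 / 2 := min_le_right _ _
  have hinner : ∀ x ∈ 𝒳, ENNReal.ofReal (lam * ℓ) ≤
      ∫⁻ r in Icc (0 : ℝ) 1, ENNReal.ofReal (f r x) := by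
    intro x hx
    obtain ⟨a, ha0, ha1, ha2, ha3⟩ : ∃ a, 0 ≤ a ∧ a + ℓ ≤ 1 ∧ mode x ≤ a + ℓ ∧ a ≤ mode x := by
      obtain ⟨h0, h1⟩ := hmode x hx
      rcases le_total (mode x) (1 / 2) with h | h
      · exact ⟨mode x, h0, by linarith, by linarith, le_rfl⟩
      · exact ⟨mode x - ℓ, by linarith, by linarith, by linarith, by linarith⟩
    calc ENNReal.ofReal (lam * ℓ)
        = ∫⁻ _ in Icc a (a + ℓ), ENNReal.ofReal lam := by
          rw [setLIntegral_const, Real.volume_Icc, ENNReal.ofReal_mul hlam.le]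
          congr 2
          ring
      _ ≤ ∫⁻ r in Icc a (a + ℓ), ENNReal.ofReal (f r x) := by
          refine setLIntegral_mono' measurableSet_Icc fun r hr => ENNReal.ofReal_le_ofReal ?_
          exact hlow x hx r ⟨by linarith [hr.1], by linarith [hr.2]⟩
            (abs_le.2 ⟨by linarith [hr.1], by linarith [hr.2]⟩)
      _ ≤ _ := lintegral_mono_set (Icc_subset_Icc ha0 ha1)
  have hm : AEMeasurable (fun p : ℝ × Ctx d => ENNReal.ofReal (f p.1 p.2))
      ((volume.restrict (Icc (0 : ℝ) 1)).prod (volume.restrict 𝒳)) := by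
    rw [Measure.prod_restrict, ← Measure.volume_eq_prod]
    exact (hfc.aemeasurable (measurableSet_Icc.prod h𝒳)).ennreal_ofReal
  have h1 := lintegral_density h𝒳 hf
  rw [Measure.volume_eq_prod, ← Measure.prod_restrict, lintegral_prod_symm _ hm] at h1
  have h2 : ENNReal.ofReal (lam * ℓ) * volume 𝒳 ≤ 1 := by
    rw [← h1, ← setLIntegral_const]
    exact setLIntegral_mono' h𝒳 hinner
  have h0 : 0 < lam * ℓ := by positivity
  rw [one_div, ENNReal.ofReal_inv_of_pos h0, ← one_div,
    ENNReal.le_div_iff_mul_le (Or.inl (by simpa using h0)) (Or.inl ENNReal.ofReal_ne_top),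
    mul_comm]
  exact h2

/-! ### Nets of the context space -/

/-- Disjoint balls of radius `η / 2` around the points of an `η`-separated set each take up a
fixed volume of `𝒳`. -/
lemma card_separated_le {𝒳 : Set (Ctx d)} {c V η : ℝ} (h𝒳 : MeasurableSet 𝒳)
    (hth : IsThick 𝒳 c) (hV0 : 0 ≤ V) (hV : volume 𝒳 ≤ ENNReal.ofReal V)
    (hη : 0 < η) (hη1 : η ≤ 1) {T : Finset (Ctx d)} (hT : ↑T ⊆ 𝒳)
    (hsep : ∀ x ∈ T, ∀ y ∈ T, x ≠ y → η < dist x y) :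
    T.card * (c * (η / 2) ^ d) ≤ V := by
  have hdisj : (T : Set (Ctx d)).PairwiseDisjoint
      fun x => Metric.closedBall x (η / 2) ∩ 𝒳 := by
    intro x hx y hy hxy
    refine Disjoint.mono inter_subset_left inter_subset_left
      (Metric.closedBall_disjoint_closedBall ?_)
    linarith [hsep x hx y hy hxy]
  have h1 : ∑ x ∈ T, volume (Metric.closedBall x (η / 2) ∩ 𝒳) ≤ volume 𝒳 := by
    rw [← measure_biUnion_finset hdisj fun x _ => Metric.isClosed_closedBall.measurableSet.inter h𝒳]
    exact measure_mono (iUnion₂_subset fun _ _ => inter_subset_right)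
  have h2 : ∑ _x ∈ T, ENNReal.ofReal (c * (η / 2) ^ d) ≤ ENNReal.ofReal V :=
    (Finset.sum_le_sum fun x hx => hth x (hT hx) (η / 2) (by positivity) (by linarith)).trans
      (h1.trans hV)
  rw [Finset.sum_const, nsmul_eq_mul, ← ENNReal.ofReal_natCast,
    ← ENNReal.ofReal_mul (Nat.cast_nonneg _)] at h2
  exact (ENNReal.ofReal_le_ofReal_iff hV0).1 h2

lemma exists_net {𝒳 : Set (Ctx d)} {c V η : ℝ} (h𝒳 : MeasurableSet 𝒳) (hc : 0 < c)
    (hth : IsThick 𝒳 c) (hV0 : 0 ≤ V) (hV : volume 𝒳 ≤ ENNReal.ofReal V)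
    (hη : 0 < η) (hη1 : η ≤ 1) :
    ∃ T : Finset (Ctx d), ↑T ⊆ 𝒳 ∧ (∀ x ∈ 𝒳, ∃ y ∈ T, ‖x - y‖ ≤ η) ∧
      T.card * (c * (η / 2) ^ d) ≤ V := by
  classical
  set P : Set ℕ := {N | ∃ T : Finset (Ctx d), ↑T ⊆ 𝒳 ∧
    (∀ x ∈ T, ∀ y ∈ T, x ≠ y → η < dist x y) ∧ T.card = N}
  have hv : 0 < c * (η / 2) ^ d := by positivity
  have hbdd : BddAbove P := by
    refine ⟨⌈V / (c * (η / 2) ^ d)⌉₊, ?_⟩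
    rintro N ⟨T, hT, hsep, rfl⟩
    have h := card_separated_le h𝒳 hth hV0 hV hη hη1 hT hsep
    have h' : (T.card : ℝ) ≤ V / (c * (η / 2) ^ d) := by rwa [le_div_iff₀ hv]
    exact_mod_cast h'.trans (Nat.le_ceil _)
  obtain ⟨N, ⟨T, hT, hsep, hcard⟩, hmax⟩ :=
    hbdd.exists_isGreatest_of_nonempty ⟨0, ∅, by simp, by simp, by simp⟩
  refine ⟨T, hT, fun x hx => ?_, card_separated_le h𝒳 hth hV0 hV hη hη1 hT hsep⟩
  by_contra! hfar
  -- otherwise `x` could be added to the separated set of largest cardinality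
  have hxT : x ∉ T := fun h => by
    have := hfar x h
    simp only [sub_self, norm_zero] at this
    linarith
  have hmem : N + 1 ∈ P := by
    refine ⟨insert x T, ?_, ?_, by rw [Finset.card_insert_of_notMem hxT, hcard]⟩
    · rw [Finset.coe_insert]
      exact insert_subset hx hT
    · intro a ha b hb hab
      rw [Finset.mem_insert] at ha hb
      rcases ha with rfl | ha <;> rcases hb with rfl | hb
      · exact absurd rfl hab
      · rw [dist_eq_norm]
        exact hfar b hb
      · rw [dist_comm, dist_eq_norm]
        exact hfar a ha
      · exact hsep a ha b hb hab
  have := hmax hmem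
  omega

/-! ### Comparing nearest-neighbour radii -/

lemma knnRadius_le {n : ℕ} {S : Fin n → ℝ × Ctx d} {k : ℕ} {p : ℝ × Ctx d} {ρ : ℝ} (hρ : 0 ≤ ρ)
    (h : k ≤ {i | S i ∈ jointBall p ρ}.ncard) : knnRadius S k p ≤ ρ :=
  csInf_le ⟨0, fun _ h => h.1⟩ ⟨hρ, h⟩

/-- If the ball of radius `ρ` around `(r₁, y)` holds `k` sample points and the slightly larger ball
around `(r₂, y)` does not, then at every context `x` near `y` the reward `r₁` has the smaller
nearest-neighbour radius. -/
lemma knnRadius_lt_knnRadius {n : ℕ} {S : Fin n → ℝ × Ctx d} {k : ℕ} {x y : Ctx d}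
    {r₁ r₂ ρ η : ℝ} (hρ : 0 ≤ ρ) (hη : 0 < η) (hxy : ‖x - y‖ ≤ η)
    (h₁ : k ≤ {i | S i ∈ jointBall (r₁, y) ρ}.ncard)
    (h₂ : {i | S i ∈ jointBall (r₂, y) (ρ + 3 * η)}.ncard < k) :
    knnRadius S k (r₁, x) < knnRadius S k (r₂, x) := by
  have hle : knnRadius S k (r₁, x) ≤ ρ + η := by
    refine knnRadius_le (by linarith) (h₁.trans (ncard_le_ncard ?_ (toFinite _)))
    intro i hi
    have h := jointDist_triangle (r₁, x) (r₁, y) (S i)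
    rw [jointDist_same_fst] at h
    have hi' : jointDist (r₁, y) (S i) ≤ ρ := hi
    change jointDist (r₁, x) (S i) ≤ ρ + η
    linarith
  have hge : ρ + 2 * η ≤ knnRadius S k (r₂, x) := by
    refine le_csInf ?_ ?_
    -- a radius exceeding the distances to all sample points shows that the infimum is not vacuous
    · refine ⟨∑ i, jointDist (r₂, x) (S i),
        Finset.sum_nonneg fun i _ => jointDist_nonneg _ _, ?_⟩
      have : {i : Fin n | jointDist (r₂, x) (S i) ≤ ∑ i, jointDist (r₂, x) (S i)} = univ :=
        eq_univ_of_forall fun i => Finset.single_le_sum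
          (f := fun i => jointDist (r₂, x) (S i)) (fun i _ => jointDist_nonneg _ _)
          (Finset.mem_univ i)
      rw [this]
      exact h₁.trans (ncard_le_ncard (subset_univ _) (toFinite _))
    · rintro ρ' ⟨-, hρ'⟩
      by_contra! hlt
      refine absurd (hρ'.trans (ncard_le_ncard ?_ (toFinite _))) (not_le.2 h₂)
      intro i hi
      have h := jointDist_triangle (r₂, y) (r₂, x) (S i)
      rw [jointDist_same_fst, norm_sub_rev] at h
      have hi' : jointDist (r₂, x) (S i) ≤ ρ' := hi
      change jointDist (r₂, y) (S i) ≤ ρ + 3 * η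
      linarith
  linarith

/-- A grid point close to `r₀` whose distance to both ends of `[0,1]` is at least `ρ`. -/
lemma exists_mem_rewardGrid {m : ℕ} (hm : 0 < m) {r₀ ρ : ℝ} (hr₀ : r₀ ∈ Icc (0 : ℝ) 1)
    (hρ : 0 < ρ) (hρm : 2 * ρ + 1 / m ≤ 1) :
    ∃ r ∈ rewardGrid m, 0 ≤ r - ρ ∧ r + ρ ≤ 1 ∧ |r - r₀| ≤ ρ + 2 / m := by
  have hm' : (0 : ℝ) < m := Nat.cast_pos.2 hm
  have hm1 : 0 < 1 / (m : ℝ) := by positivity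
  obtain ⟨t, ht0, ht1, ht2, ht3⟩ : ∃ t, ρ ≤ t ∧ t ≤ 1 - ρ - 1 / m ∧ r₀ - ρ - 1 / m ≤ t ∧
      t ≤ r₀ + ρ := by
    obtain ⟨h0, h1⟩ := hr₀
    rcases le_total r₀ ρ with h | h
    · exact ⟨ρ, le_rfl, by linarith, by linarith, by linarith⟩
    · rcases le_total r₀ (1 - ρ - 1 / m) with h' | h'
      · exact ⟨r₀, h, h', by linarith, by linarith⟩
      · exact ⟨1 - ρ - 1 / m, by linarith, le_rfl, by linarith, by linarith⟩
  have hpos : 0 < t * m := by nlinarith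
  have hj1 := Nat.le_ceil (t * m)
  have hj2 := Nat.ceil_lt_add_one hpos.le
  have hd1 : t ≤ (⌈t * m⌉₊ : ℝ) / m := by rwa [le_div_iff₀ hm']
  have hd2 : (⌈t * m⌉₊ : ℝ) / m < t + 1 / m := by
    rw [div_lt_iff₀ hm', add_mul, one_div, inv_mul_cancel₀ hm'.ne']
    exact hj2
  have h2 : 2 / (m : ℝ) = 1 / m + 1 / m := by ring
  refine ⟨(⌈t * m⌉₊ : ℝ) / m, ⟨⌈t * m⌉₊, Nat.one_le_ceil_iff.2 hpos, ?_, rfl⟩,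
    by linarith, by linarith, abs_le.2 ⟨by linarith, by linarith⟩⟩
  have : (⌈t * m⌉₊ : ℝ) / m < 1 := by linarith
  rw [div_lt_one hm'] at this
  exact_mod_cast this

/-! ### The estimate at one context -/

/-- Scales at which the comparison of balls works: `τ` is the relative precision to which the
masses of balls are known, `η` the mesh of the net of contexts, `R` a bound for the relevant radii
(up to multiples of `η`), and `m` the inverse mesh of the grid of rewards. -/
structure AdmissibleScales (d : ℕ) (α Cα Cup rM lam c B : ℝ) (n k m : ℕ) (τ η R : ℝ) : Prop where
  n_pos : 0 < n
  k_pos : 0 < k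
  m_pos : 0 < m
  tau_pos : 0 < τ
  tau_le : τ ≤ 1 / 8
  eta_pos : 0 < η
  R_pos : 0 < R
  R_le : R ≤ 1
  /-- balls of radius `η` have negligible mass -/
  eta_small : unitVol d * η ^ (d + 1) < k / (n * B)
  /-- balls of radius `R` have enough mass near the modes -/
  R_large : 2 * k / (n * lam) ≤ c * (R / 2) ^ d * R
  /-- spherical shells of width `4 η` have negligible mass -/
  shell : unitVol d * ((d + 1) * (4 * η) * (R + 4 * η) ^ d) ≤ τ * (k / (n * B))
  /-- the relevant balls fit into `[0,1]` -/
  fit : 2 * (R + 4 * η) + 1 / m ≤ 1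
  /-- the relevant balls lie within the range of the quadratic expansion -/
  range : R + 4 * η + 2 / m ≤ rM
  /-- the oscillation of the density over the relevant balls is negligible -/
  osc : Cup * (R + 4 * η + 2 / m) ^ 2 + Cα * (R + 4 * η) ^ α ≤ τ * lam

/-- At a context `y` there are a radius `ρ` and a grid point `r₁` near the mode such that, with
high probability, the `ρ`-ball around `(r₁, y)` holds `k` sample points, while slightly larger balls
around `(r, y)` do not, for the `r` at which the density is clearly below its maximum. -/
lemma exists_radius_and_gridPoint {𝒳 : Set (Ctx d)} {f : ℝ → Ctx d → ℝ} {mode : Ctx d → ℝ}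
    {α Cα Clow Cup rM lam c B τ η R : ℝ} {n k m : ℕ}
    (hα : 0 < α) (hCα : 0 < Cα) (hCup : 0 < Cup) (hlam : 0 < lam) (hrM : 0 < rM)
    (h𝒳 : MeasurableSet 𝒳) (hth : IsThick 𝒳 c) (hf : IsJointDensity 𝒳 f)
    (hreg : ConditionalRegularity 𝒳 f α Cα Clow Cup rM lam)
    (hmode : ∀ x ∈ 𝒳, IsTheMode (condDensity f x) (mode x)) (hB : IsSupBound 𝒳 f B)
    (hs : AdmissibleScales d α Cα Cup rM lam c B n k m τ η R) {y : Ctx d} (hy : y ∈ 𝒳) :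
    ∃ ρ, 0 ≤ ρ ∧ ∃ r₁ ∈ rewardGrid m,
      Measure.pi (fun _ : Fin n => jointLaw 𝒳 f)
        {S | {i | S i ∈ jointBall (r₁, y) ρ}.ncard < k} ≤
          ENNReal.ofReal (Real.exp (-(k * τ ^ 2 / 8))) ∧
      ∀ r ∈ Icc (0 : ℝ) 1, f r y + (8 * τ * B + Cα * (R + 4 * η) ^ α) ≤ f (mode y) y →
        Measure.pi (fun _ : Fin n => jointLaw 𝒳 f)
          {S | k ≤ {i | S i ∈ jointBall (r, y) (ρ + 3 * η)}.ncard} ≤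
            ENNReal.ofReal (Real.exp (-(k * τ ^ 2 / 8))) := by
  have := isProbabilityMeasure_jointLaw h𝒳 hf
  obtain ⟨hn, hk, hm, hτ, hτ1, hη, hR, hR1, hηs, hRl, hsh, hfit, hran, hosc⟩ := hs
  have hloc := (hmode y hy).isLocalMode
  have hI := (hmode y hy).1
  have hn' : (0 : ℝ) < n := Nat.cast_pos.2 hn
  have hk' : (0 : ℝ) < k := Nat.cast_pos.2 hk
  set M := f (mode y) y
  have hlM : lam ≤ M := hreg.lower y hy _ hloc _ hI (by simpa using hrM.le)
  have hMB : M ≤ B := hB y hy _ hI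
  have hM0 : 0 < M := hlam.trans_le hlM
  have hB0 : 0 < B := hM0.trans_le hMB
  set v := (1 + 3 * τ) * (k / (n * M)) with hv
  have hkB : (k : ℝ) / (n * B) ≤ k / (n * M) := by gcongr
  have hkM : 0 < (k : ℝ) / (n * M) := by positivity
  have hτM := mul_pos hτ hkM
  have hv1 : (k : ℝ) / (n * B) ≤ v := by linarith
  have hvR : v ≤ sliceVol 𝒳 y R := by
    refine le_trans ?_ (hRl.trans (le_sliceVol hth hy hR hR1))
    have : (k : ℝ) / (n * M) ≤ k / (n * lam) := by gcongr
    have h1 := mul_le_mul_of_nonneg_right hτ1 hkM.le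
    rw [mul_div_assoc]
    linarith
  obtain ⟨ρ, hρη, hρR, hρv, hρ3⟩ := exists_radius y hη (hηs.trans_le hv1) hvR
  have hρ0 : 0 < ρ := hη.trans hρη
  obtain ⟨r₁, hr₁, hr0, hr1, hrd⟩ := exists_mem_rewardGrid hm hI hρ0 (by linarith)
  have hr₁I : r₁ ∈ Icc (0 : ℝ) 1 := ⟨by linarith, by linarith⟩
  -- the oscillation over a ball of radius at most `R + 4 η` around a point of the strip
  have hosc' : ∀ r ∈ Icc (0 : ℝ) 1, ∀ ρ' ≤ R + 4 * η,
      ∀ q ∈ jointBall (r, y) ρ' ∩ Icc (0 : ℝ) 1 ×ˢ 𝒳,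
        |f r y - f q.1 q.2| ≤ Cα * (R + 4 * η) ^ α := by
    rintro r hr ρ' hρ' q ⟨hq, hq1, hq2⟩
    refine (hreg.holder y hy q.2 hq2 r hr q.1 hq1).trans ?_
    gcongr
    · exact jointDist_nonneg _ _
    · exact le_trans hq hρ'
  have hr : ∀ w : ℝ, n * (w * (k / (n * M)) * M) = w * k := by
    intro w
    field_simp
  refine ⟨ρ, hρ0.le, r₁, hr₁, ?_, ?_⟩
  · refine pi_count_lt_le _ (measurableSet_jointBall _ _) n k hτ (by linarith) ?_
    have hquad := (hreg.quadratic y hy _ hloc r₁ hr₁I (by linarith)).2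
    have hsq : (mode y - r₁) ^ 2 ≤ (R + 4 * η + 2 / m) ^ 2 := by
      rw [← sq_abs, abs_sub_comm]
      gcongr
      linarith
    have hlow : ∀ q ∈ jointBall (r₁, y) ρ ∩ Icc (0 : ℝ) 1 ×ˢ 𝒳, M * (1 - τ) ≤ f q.1 q.2 := by
      intro q hq
      have h1 := abs_le.1 (hosc' r₁ hr₁I ρ (by linarith) q hq)
      have h2 := abs_le.1 hquad
      have h3 := mul_le_mul_of_nonneg_left hsq hCup.le
      have h4 := mul_le_mul_of_nonneg_left hlM hτ.le
      linarith [h1.2, h2.2]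
    have hmass := le_jointLaw_jointBall h𝒳 (mul_nonneg hM0.le (by linarith)) hr0 hr1 hlow
    rw [ENNReal.ofReal_le_iff_le_toReal (measure_ne_top _ _)] at hmass
    have h1 : (1 + τ) * k ≤ n * (M * (1 - τ) * v) := by
      have : n * (M * (1 - τ) * v) = ((1 - τ) * (1 + 3 * τ)) * k := by
        rw [← hr, hv]
        ring
      have h2 := mul_le_mul_of_nonneg_right hτ1 hτ.le
      rw [this]
      gcongr
      linarith
    refine h1.trans (mul_le_mul_of_nonneg_left (le_trans ?_ hmass) hn'.le)
    exact mul_le_mul_of_nonneg_left hρv (mul_nonneg hM0.le (by linarith))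
  · intro r hrI hrlow
    refine pi_le_count_le _ (measurableSet_jointBall _ _) n k hτ (by linarith) ?_
    have hb0 : 0 ≤ M * (1 - 8 * τ) := mul_nonneg hM0.le (by linarith)
    have hup : ∀ q ∈ jointBall (r, y) (ρ + 3 * η) ∩ Icc (0 : ℝ) 1 ×ˢ 𝒳,
        f q.1 q.2 ≤ M * (1 - 8 * τ) := by
      intro q hq
      have h1 := abs_le.1 (hosc' r hrI (ρ + 3 * η) (by linarith) q hq)
      have h2 := mul_le_mul_of_nonneg_left hMB hτ.le
      linarith [h1.1]
    have hmass := ENNReal.toReal_le_of_le_ofReal (mul_nonneg hb0 (sliceVol_nonneg _ _ _))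
      (jointLaw_jointBall_le h𝒳 hb0 hup)
    have hvol : sliceVol 𝒳 y (ρ + 3 * η) ≤ (1 + 4 * τ) * (k / (n * M)) := by
      refine hρ3.trans ?_
      have h1 : unitVol d * ((d + 1) * (4 * η) * (ρ + 3 * η) ^ d) ≤
          unitVol d * ((d + 1) * (4 * η) * (R + 4 * η) ^ d) := by
        have hp : (ρ + 3 * η) ^ d ≤ (R + 4 * η) ^ d :=
          pow_le_pow_left₀ (by linarith) (by linarith) d
        exact mul_le_mul_of_nonneg_left (mul_le_mul_of_nonneg_left hp (by positivity))
          (unitVol_nonneg d)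
      have h2 := mul_le_mul_of_nonneg_left hkB hτ.le
      linarith
    refine (mul_le_mul_of_nonneg_left (hmass.trans
      (mul_le_mul_of_nonneg_left hvol hb0)) hn'.le).trans ?_
    have : n * (M * (1 - 8 * τ) * ((1 + 4 * τ) * (k / (n * M)))) =
        ((1 - 8 * τ) * (1 + 4 * τ)) * k := by
      rw [← hr]
      ring
    have h2 := mul_pos hτ hτ
    rw [this]
    gcongr
    linarith

/-! ### The union bound -/

/-- Union bound over the net of contexts and, at each of its points, over the grid of rewards. -/
lemma pi_exists_far_le {𝒳 : Set (Ctx d)} {f : ℝ → Ctx d → ℝ} {mode : Ctx d → ℝ}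
    {α Cα Clow Cup rM lam c B τ η R ε : ℝ} {n k m : ℕ}
    (hα : 0 < α) (hCα : 0 < Cα) (hCup : 0 < Cup) (hlam : 0 < lam) (hrM : 0 < rM)
    (h𝒳 : MeasurableSet 𝒳) (hth : IsThick 𝒳 c) (hf : IsJointDensity 𝒳 f)
    (hreg : ConditionalRegularity 𝒳 f α Cα Clow Cup rM lam)
    (hmode : ∀ x ∈ 𝒳, IsTheMode (condDensity f x) (mode x)) (hB : IsSupBound 𝒳 f B)
    (hs : AdmissibleScales d α Cα Cup rM lam c B n k m τ η R)
    (hε : ∀ x ∈ 𝒳, ∀ r ∈ Icc (0 : ℝ) 1, ε ≤ |r - mode x| →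
      f r x + (8 * τ * B + Cα * (R + 4 * η) ^ α + 2 * (Cα * η ^ α)) ≤ f (mode x) x)
    {T : Finset (Ctx d)} (hT : ↑T ⊆ 𝒳) (hnet : ∀ x ∈ 𝒳, ∃ y ∈ T, ‖x - y‖ ≤ η)
    {modeHat : (Fin n → ℝ × Ctx d) → Ctx d → ℝ}
    (hhat : ∀ S, ∀ x ∈ 𝒳, IsModeEstimate S k m x (modeHat S x)) :
    Measure.pi (fun _ : Fin n => jointLaw 𝒳 f) {S | ∃ x ∈ 𝒳, ε ≤ |modeHat S x - mode x|} ≤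
      ENNReal.ofReal (T.card * m * Real.exp (-(k * τ ^ 2 / 8))) := by
  classical
  have hmode' : ∀ x ∈ 𝒳, ∀ r ∈ Icc (0 : ℝ) 1, f r x ≤ f (mode x) x := by
    intro x hx r hr
    have h := (hmode x hx).of_condDensity hf hx
    by_cases hne : r = mode x
    · rw [hne]
    · exact (h.2 r hr hne).le
  have hgrid : ∀ r ∈ rewardGrid m, r ∈ Icc (0 : ℝ) 1 := by
    rintro r ⟨j, hj, hjm, rfl⟩
    exact ⟨by positivity, div_le_one_of_le₀ (by exact_mod_cast hjm.le) (Nat.cast_nonneg _)⟩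
  have hloc := fun y (hy : y ∈ 𝒳) =>
    exists_radius_and_gridPoint hα hCα hCup hlam hrM h𝒳 hth hf hreg hmode hB hs hy
  choose! ρ hρ r₁ hr₁ hnear hfar using hloc
  set e := ENNReal.ofReal (Real.exp (-(k * τ ^ 2 / 8))) with he
  set P := Measure.pi (fun _ : Fin n => jointLaw 𝒳 f)
  -- the event that goes wrong at the net point `y`: index `0` stands for the ball near the mode,
  -- index `j > 0` for the grid point `j / m`
  set E : Ctx d → ℕ → Set (Fin n → ℝ × Ctx d) := fun y j =>
    if j = 0 then {S | {i | S i ∈ jointBall (r₁ y, y) (ρ y)}.ncard < k}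
    else if f ((j : ℝ) / m) y + (8 * τ * B + Cα * (R + 4 * η) ^ α) ≤ f (mode y) y then
      {S | k ≤ {i | S i ∈ jointBall ((j : ℝ) / m, y) (ρ y + 3 * η)}.ncard}
    else ∅ with hE
  have hEe : ∀ y ∈ T, ∀ j ∈ Finset.range m, P (E y j) ≤ e := by
    intro y hy j hj
    simp only [hE]
    split_ifs with h0 h1
    · exact hnear y (hT hy)
    · exact hfar y (hT hy) _ (hgrid _ ⟨j, Nat.one_le_iff_ne_zero.2 h0, Finset.mem_range.1 hj, rfl⟩)
        h1
    · simp
  have hsub : {S | ∃ x ∈ 𝒳, ε ≤ |modeHat S x - mode x|} ⊆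
      ⋃ y ∈ T, ⋃ j ∈ Finset.range m, E y j := by
    rintro S ⟨x, hx, hfarx⟩
    obtain ⟨y, hyT, hxy⟩ := hnet x hx
    have hy := hT hyT
    simp only [mem_iUnion, exists_prop]
    refine ⟨y, hyT, ?_⟩
    by_contra! hgood
    obtain ⟨hmem, hmin⟩ := hhat S x hx
    obtain ⟨j, hj1, hjm, hj⟩ := id hmem
    have hI := hgrid _ hmem
    have hj0 : j ≠ 0 := by omega
    have hA := hgood 0 (Finset.mem_range.2 hs.m_pos)
    have hBj := hgood j (Finset.mem_range.2 hjm)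
    -- by Hölder continuity the estimate is also clearly worse than the mode at `y`
    have hlow : f ((j : ℝ) / m) y + (8 * τ * B + Cα * (R + 4 * η) ^ α) ≤ f (mode y) y := by
      rw [← hj]
      have hhol : ∀ r ∈ Icc (0 : ℝ) 1, |f r x - f r y| ≤ Cα * η ^ α := by
        intro r hr
        refine (hreg.holder x hx y hy r hr r hr).trans ?_
        rw [jointDist_same_fst]
        gcongr
      have h1 := abs_le.1 (hhol _ hI)
      have h2 := abs_le.1 (hhol _ (hmode x hx).1)
      linarith [hε x hx _ hI hfarx, hmode' y hy _ (hmode x hx).1]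
    simp only [hE, hj0, hlow, if_true, if_false, mem_ofPred_eq, not_lt, not_le] at hA hBj
    have := knnRadius_lt_knnRadius (hρ y hy) hs.eta_pos hxy hA hBj
    rw [← hj] at this
    exact absurd (hmin _ (hr₁ y hy)) (not_le.2 this)
  calc P {S | ∃ x ∈ 𝒳, ε ≤ |modeHat S x - mode x|}
      ≤ ∑ y ∈ T, ∑ j ∈ Finset.range m, P (E y j) :=
        (measure_mono hsub).trans ((measure_biUnion_finset_le _ _).trans
          (Finset.sum_le_sum fun y _ => measure_biUnion_finset_le _ _))
    _ ≤ ∑ _y ∈ T, ∑ _j ∈ Finset.range m, e :=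
        Finset.sum_le_sum fun y hy => Finset.sum_le_sum fun j hj => hEe y hy j hj
    _ = ENNReal.ofReal (T.card * m * Real.exp (-(k * τ ^ 2 / 8))) := by
        rw [Finset.sum_const, Finset.sum_const, Finset.card_range, nsmul_eq_mul, nsmul_eq_mul, he,
          ENNReal.ofReal_mul (by positivity), ENNReal.ofReal_mul (by positivity),
          ENNReal.ofReal_natCast, ENNReal.ofReal_natCast, mul_assoc]

/-! ### Choice of the scales -/

lemma rpow_scale_le {α K s u : ℝ} (hα : 0 < α) (hα1 : α ≤ 1) (hK : 1 ≤ K) (hs : 0 < s)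
    (hs1 : s ≤ 1) (hsu : s ^ α ≤ u) : (K * s + 4 * s ^ 2) ^ α ≤ (K + 4) * u := by
  have h1 : K * s + 4 * s ^ 2 ≤ (K + 4) * s := by nlinarith
  calc (K * s + 4 * s ^ 2) ^ α ≤ ((K + 4) * s) ^ α := by gcongr
    _ = (K + 4) ^ α * s ^ α := Real.mul_rpow (by linarith) hs.le
    _ ≤ (K + 4) * u := by
        gcongr
        exact Real.rpow_le_self_of_one_le (by linarith) hα1

/-- With radii of order `s`, `k / n` of order `s ^ (d + 1)`, oscillations of order `u = s ^ α`, and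
`L` a large factor, the precision `u * L` is admissible. -/
lemma admissibleScales_of_le {α Cα Cup rM lam c B K s u L : ℝ} {n k m : ℕ}
    (hα : 0 < α) (hα1 : α ≤ 1) (hCα : 0 < Cα) (hCup : 0 < Cup) (hlam : 0 < lam) (hB : 0 < B)
    (hn : 0 < n) (hk : 0 < k) (hm : 0 < m) (hs : 0 < s) (hsu : s ≤ u) (hu1 : u ≤ 1)
    (hsα : s ^ α ≤ u) (hL : 0 < L) (hK1 : 1 ≤ K)
    (hkl : s ^ (d + 1) / 2 ≤ k / n) (hku : k / n ≤ 2 * s ^ (d + 1)) (hmu : 1 / m ≤ 4 * u)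
    (hK : 4 / lam ≤ c * (K / 2) ^ d * K) (huL : u * L ≤ 1 / 8)
    (hballs : 4 * B * unitVol d * u ≤ 1)
    (hshell : 2 * B * unitVol d * (d + 1) * 4 * (K + 4) ^ d ≤ L)
    (hfit : (2 * (K + 4) + 4) * u ≤ 1) (hrange : (K + 12) * u ≤ rM)
    (hosc : Cup * (K + 12) ^ 2 + Cα * (K + 4) ≤ L * lam) :
    AdmissibleScales d α Cα Cup rM lam c B n k m (u * L) (s ^ 2) (K * s) := by
  have hu : 0 < u := hs.trans_le hsu
  have hs1 : s ≤ 1 := hsu.trans hu1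
  have hn' : (0 : ℝ) < n := Nat.cast_pos.2 hn
  have hm' : (0 : ℝ) < m := Nat.cast_pos.2 hm
  have hW := unitVol_nonneg d
  have hR' : K * s + 4 * s ^ 2 ≤ (K + 4) * s := by nlinarith
  have hR'u : K * s + 4 * s ^ 2 ≤ (K + 4) * u := hR'.trans (by gcongr)
  have hR'm : K * s + 4 * s ^ 2 + 2 / m ≤ (K + 12) * u := by
    have : 2 / (m : ℝ) = 2 * (1 / m) := by ring
    linarith
  have hsd : s ^ (d + 1) ≤ u := (pow_le_of_le_one hs.le hs1 (Nat.succ_ne_zero d)).trans hsu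
  have hsd0 : 0 < s ^ (d + 1) := by positivity
  have hkB : s ^ (d + 1) / (2 * B) ≤ k / (n * B) := by
    rw [← div_div, ← div_div]
    gcongr
  refine ⟨hn, hk, hm, by positivity, huL, by positivity, by positivity, ?_, ?_, ?_, ?_, ?_, ?_, ?_⟩
  · nlinarith
  · refine lt_of_lt_of_le ?_ hkB
    rw [lt_div_iff₀ (by positivity), ← pow_mul, mul_comm 2, pow_mul]
    have h1 : 2 * B * unitVol d * s ^ (d + 1) ≤ 2 * B * unitVol d * u := by gcongr
    have h2 : 2 * B * unitVol d * s ^ (d + 1) < 1 := by linarith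
    calc unitVol d * (s ^ (d + 1)) ^ 2 * (2 * B)
        = (2 * B * unitVol d * s ^ (d + 1)) * s ^ (d + 1) := by ring
      _ < 1 * s ^ (d + 1) := by gcongr
      _ = s ^ (d + 1) := one_mul _
  · calc 2 * (k : ℝ) / (n * lam) = 2 * (k / n) / lam := by field_simp
      _ ≤ 2 * (2 * s ^ (d + 1)) / lam := by gcongr
      _ = 4 / lam * s ^ (d + 1) := by ring
      _ ≤ c * (K / 2) ^ d * K * s ^ (d + 1) := by gcongr
      _ = c * (K * s / 2) ^ d * (K * s) := by
          rw [mul_div_right_comm, mul_pow]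
          ring
  · refine le_trans ?_ (mul_le_mul_of_nonneg_left hkB (by positivity))
    have h1 : (K * s + 4 * s ^ 2) ^ d ≤ ((K + 4) * s) ^ d := by gcongr
    calc unitVol d * ((d + 1) * (4 * s ^ 2) * (K * s + 4 * s ^ 2) ^ d)
        ≤ unitVol d * ((d + 1) * (4 * s ^ 2) * ((K + 4) * s) ^ d) := by gcongr
      _ = (2 * B * unitVol d * (d + 1) * 4 * (K + 4) ^ d) * s * (s ^ (d + 1) / (2 * B)) := by
          rw [mul_pow]
          field_simp
          ring
      _ ≤ L * u * (s ^ (d + 1) / (2 * B)) := by gcongr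
      _ = u * L * (s ^ (d + 1) / (2 * B)) := by ring
  · linarith
  · exact hR'm.trans hrange
  · have h1 : (K * s + 4 * s ^ 2 + 2 / m) ^ 2 ≤ (K + 12) ^ 2 * u := by
      calc (K * s + 4 * s ^ 2 + 2 / m) ^ 2 ≤ ((K + 12) * u) ^ 2 := by gcongr
        _ = (K + 12) ^ 2 * u * u := by ring
        _ ≤ (K + 12) ^ 2 * u * 1 := by gcongr
        _ = (K + 12) ^ 2 * u := mul_one _
    have h2 := rpow_scale_le hα hα1 hK1 hs hs1 hsα
    calc Cup * (K * s + 4 * s ^ 2 + 2 / m) ^ 2 + Cα * (K * s + 4 * s ^ 2) ^ α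
        ≤ Cup * ((K + 12) ^ 2 * u) + Cα * ((K + 4) * u) := by gcongr
      _ = (Cup * (K + 12) ^ 2 + Cα * (K + 4)) * u := by ring
      _ ≤ L * lam * u := by gcongr
      _ = u * L * lam := by ring

/-- The drop of the density needed in the union bound is of the order of the precision `u * L`. -/
lemma density_drop_le {α Cα B K s u L : ℝ} (hα : 0 < α) (hα1 : α ≤ 1) (hCα : 0 ≤ Cα)
    (hK : 1 ≤ K) (hs : 0 < s) (hs1 : s ≤ 1) (hsu : s ^ α ≤ u)
    (h₁ : Cα * (K + 4) ≤ L * B) (h₂ : 2 * Cα ≤ L * B) :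
    8 * (u * L) * B + Cα * (K * s + 4 * s ^ 2) ^ α + 2 * (Cα * (s ^ 2) ^ α) ≤
      10 * B * (u * L) := by
  have hu : 0 ≤ u := (Real.rpow_nonneg hs.le α).trans hsu
  have h3 := rpow_scale_le hα hα1 hK hs hs1 hsu
  have h4 : (s ^ 2) ^ α ≤ u := by
    refine le_trans ?_ hsu
    gcongr
    exact pow_le_of_le_one hs.le hs1 (by norm_num)
  calc _ ≤ 8 * (u * L) * B + Cα * ((K + 4) * u) + 2 * (Cα * u) := by gcongr
    _ = 8 * (u * L) * B + (Cα * (K + 4)) * u + (2 * Cα) * u := by ring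
    _ ≤ 8 * (u * L) * B + (L * B) * u + (L * B) * u := by gcongr
    _ = _ := by ring

lemma eventually_le_log (K : ℝ) : ∀ᶠ n : ℕ in Filter.atTop, K ≤ Real.log n :=
  (Real.tendsto_log_atTop.comp tendsto_natCast_atTop_atTop).eventually_ge_atTop K

lemma eventually_mul_exp_le {a : ℝ} (ha : 0 < a) (K : ℝ) {b : ℝ} (hb : 0 < b) :
    ∀ᶠ n : ℕ in Filter.atTop, K * (Real.exp (-(a * Real.log n)) * Real.log n) ≤ b := by
  have h := ((tendsto_rpow_mul_exp_neg_mul_atTop_nhds_zero 1 a ha).const_mul K).comp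
    (Real.tendsto_log_atTop.comp tendsto_natCast_atTop_atTop)
  rw [mul_zero] at h
  filter_upwards [h.eventually_le_const hb] with n hn
  simp only [Function.comp_apply, Real.rpow_one] at hn
  rw [mul_comm (Real.exp _), ← neg_mul]
  exact hn

/-- The number `V / (c (s² / 2) ^ d)` of net points, times the number `k²` of grid points, is
polynomial in `n = exp L`, hence negligible against the Chernoff bound `exp (-L² / 16)`. -/
lemma union_count_le {c δ V L s u A k : ℝ} (hc : 0 < c) (hδ : 0 < δ) (hV : 0 ≤ V)
    (hLV : 4 * V * 2 ^ d ≤ L * (δ * c)) (hAu : A * u ^ 2 = 1)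
    (hk0 : 0 ≤ k) (hkl : A / 2 ≤ k) (hku : k ≤ 2 * A)
    (hfin : A ^ 2 * Real.exp (-(L ^ 2 / 16)) * Real.exp L ≤ (s ^ 2) ^ d) :
    V * (k ^ 2 * Real.exp (-(k * (u * L) ^ 2 / 8))) ≤ δ * (c * (s ^ 2 / 2) ^ d) := by
  have hexp : Real.exp (-(k * (u * L) ^ 2 / 8)) ≤ Real.exp (-(L ^ 2 / 16)) := by
    refine Real.exp_le_exp.2 ?_
    have : L ^ 2 / 16 ≤ k * (u * L) ^ 2 / 8 := by
      calc L ^ 2 / 16 = (A * u ^ 2) * (L ^ 2 / 16) := by rw [hAu, one_mul]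
        _ = A / 2 * (u * L) ^ 2 / 8 := by ring
        _ ≤ _ := by gcongr
    linarith
  have hV' : 4 * V * 2 ^ d ≤ δ * c * Real.exp L := by
    have h2 := Real.add_one_le_exp L
    calc 4 * V * 2 ^ d ≤ L * (δ * c) := hLV
      _ ≤ Real.exp L * (δ * c) := by gcongr; linarith
      _ = _ := by ring
  calc V * (k ^ 2 * Real.exp (-(k * (u * L) ^ 2 / 8)))
      ≤ V * ((2 * A) ^ 2 * Real.exp (-(L ^ 2 / 16))) := by gcongr
    _ = 4 * V * 2 ^ d * (A ^ 2 * Real.exp (-(L ^ 2 / 16))) * (1 / 2) ^ d := by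
        rw [one_div, inv_pow]
        field_simp
        ring
    _ ≤ δ * c * Real.exp L * (A ^ 2 * Real.exp (-(L ^ 2 / 16))) * (1 / 2) ^ d := by gcongr
    _ = δ * c * (A ^ 2 * Real.exp (-(L ^ 2 / 16)) * Real.exp L) * (1 / 2) ^ d := by ring
    _ ≤ δ * c * (s ^ 2) ^ d * (1 / 2) ^ d := by gcongr
    _ = δ * (c * (s ^ 2 / 2) ^ d) := by
        rw [div_eq_mul_one_div (s ^ 2), mul_pow]
        ring

/-- The scales attached to the sample size `n`, written through exponentials of `log n`:
`s = n ^ (-1 / q)`, `u = s ^ α`, `w = √u` and `A = u⁻²`, with `q = 2 α + d + 1`, where `A` is `k` up to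
rounding. -/
lemma exists_scales (d : ℕ) {α : ℝ} (hα : 0 < α) (hα1 : α ≤ 1) {n k : ℕ} (hn : 0 < n)
    (hL : 48 ≤ Real.log n)
    (hu : Real.exp (-(α / (2 * α + d + 1) * Real.log n)) ≤ 1 / 2)
    (hk : |(k : ℝ) - (n : ℝ) ^ (2 * α / (2 * α + d + 1))| < 1) :
    ∃ s u w A : ℝ, u = Real.exp (-(α / (2 * α + d + 1) * Real.log n)) ∧ 0 < s ∧ s ≤ u ∧ 0 < w ∧
      0 < A ∧ s ^ α = u ∧ w ^ 2 = u ∧ A * u ^ 2 = 1 ∧ A / 2 ≤ k ∧ k ≤ 2 * A ∧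
      s ^ (d + 1) = A / n ∧ (n : ℝ) ^ (α / (4 * α + 2 * d + 2)) = w⁻¹ ∧
      A ^ 2 * Real.exp (-(Real.log n ^ 2 / 16)) * Real.exp (Real.log n) ≤ (s ^ 2) ^ d := by
  set q : ℝ := 2 * α + d + 1 with hq
  have hd0 : (0 : ℝ) ≤ d := Nat.cast_nonneg d
  have hq0 : 0 < q := by positivity
  set L := Real.log n with hLdef
  have hn' : (0 : ℝ) < n := Nat.cast_pos.2 hn
  have hnL : (n : ℝ) = Real.exp L := (Real.exp_log hn').symm
  have hLq : 0 < L / q := div_pos (by linarith) hq0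
  have hαLq : α / q * L = α * (L / q) := by ring
  have hAn : (n : ℝ) ^ (2 * α / q) = Real.exp (2 * (α / q * L)) := by
    rw [Real.rpow_def_of_pos hn']
    congr 1
    ring
  have hAu : Real.exp (2 * (α / q * L)) * Real.exp (-(α / q * L)) ^ 2 = 1 := by
    rw [← Real.exp_nat_mul, ← Real.exp_add, Real.exp_eq_one_iff]
    push_cast
    ring
  have hA2 : 2 ≤ Real.exp (2 * (α / q * L)) := by
    have h0 := Real.exp_pos (2 * (α / q * L))
    have h1 : Real.exp (-(α / q * L)) ^ 2 ≤ (1 / 2) ^ 2 := by gcongr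
    have h2 := mul_le_mul_of_nonneg_left h1 h0.le
    linarith
  rw [hAn] at hk
  obtain ⟨hk1, hk2⟩ := abs_lt.1 hk
  refine ⟨Real.exp (-(L / q)), _, Real.exp (-(α / q * L) / 2), Real.exp (2 * (α / q * L)), rfl,
    Real.exp_pos _, ?_, Real.exp_pos _, Real.exp_pos _, ?_, ?_, hAu, by linarith, by linarith,
    ?_, ?_, ?_⟩
  · refine Real.exp_le_exp.2 (neg_le_neg ?_)
    rw [hαLq]
    exact mul_le_of_le_one_left hLq.le hα1
  · rw [← Real.exp_mul]
    congr 1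
    ring
  · rw [← Real.exp_nat_mul]
    congr 1
    push_cast
    ring
  · rw [hnL, ← Real.exp_nat_mul, ← Real.exp_sub]
    congr 1
    push_cast
    field_simp
    rw [hq]
    ring
  · have h1 : 4 * α + 2 * (d : ℝ) + 2 = 2 * q := by
      rw [hq]
      ring
    rw [Real.rpow_def_of_pos hn', ← Real.exp_neg, h1, ← hLdef]
    congr 1
    field_simp
  · rw [← Real.exp_nat_mul, ← Real.exp_nat_mul, ← Real.exp_nat_mul, ← Real.exp_add,
      ← Real.exp_add, Real.exp_le_exp]
    push_cast
    have h1 : 4 * α * (L / q) + 2 * d * (L / q) ≤ 2 * L := by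
      have h2 : 2 * L = 2 * q * (L / q) := by field_simp
      rw [h2, ← add_mul]
      gcongr
      linarith
    have h3 : 48 * L ≤ L ^ 2 := by
      rw [sq]
      gcongr
    have h4 : (2 : ℝ) * (2 * (α / q * L)) = 4 * α * (L / q) := by ring
    have h5 : (d : ℝ) * (2 * -(L / q)) = -(2 * d * (L / q)) := by ring
    rw [h4, h5]
    linarith

/-- For large `n` the scales `η = s²`, `R = K s`, `τ = s ^ α log n` with
`s = n ^ (-1 / (2 α + d + 1))` are admissible, a drop of the density of order `τ` is forced at half
the distance claimed in the theorem, and the union bound gives at most `δ`. -/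
lemma eventually_exists_admissibleScales (d : ℕ) {α Cα Clow Cup rM lam c C₀ δ B γ V : ℝ}
    (hα : 0 < α) (hα1 : α ≤ 1) (hCα : 0 < Cα) (hClow : 0 < Clow) (hCup : 0 < Cup)
    (hrM : 0 < rM) (hlam : 0 < lam) (hc : 0 < c) (hC₀ : 0 < C₀) (hδ : 0 < δ) (hδ1 : δ < 1)
    (hB : 0 < B) (hγ : 0 < γ) (hV : 0 ≤ V) :
    ∀ᶠ n : ℕ in Filter.atTop, ∀ k : ℕ, |(k : ℝ) - (n : ℝ) ^ (2 * α / (2 * α + d + 1))| < 1 →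
      ∃ τ η R ε : ℝ, AdmissibleScales d α Cα Cup rM lam c B n k (k ^ 2) τ η R ∧ η ≤ 1 ∧ 0 < ε ∧
        2 * ε = C₀ * (Real.sqrt (Real.log (1 / δ)) * Real.log n
                  / (n : ℝ) ^ (α / (4 * α + 2 * d + 2))) ∧
        8 * τ * B + Cα * (R + 4 * η) ^ α + 2 * (Cα * η ^ α) ≤ min γ (Clow * ε ^ 2) ∧
        V * (k ^ 2 * Real.exp (-(k * τ ^ 2 / 8))) ≤ δ * (c * (η / 2) ^ d) := by
  set q : ℝ := 2 * α + d + 1 with hq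
  have hd0 : (0 : ℝ) ≤ d := Nat.cast_nonneg d
  have hq0 : 0 < q := by positivity
  have ha : 0 < α / q := by positivity
  set σ := Real.sqrt (Real.log (1 / δ))
  have hσ0 : 0 < σ := Real.sqrt_pos.2 (Real.log_pos (by rw [lt_div_iff₀ hδ]; linarith))
  set K : ℝ := max 1 (4 / lam / (c * (1 / 2) ^ d))
  have hK1 : 1 ≤ K := le_max_left _ _
  have hK : 4 / lam ≤ c * (K / 2) ^ d * K := by
    have h1 : 4 / lam ≤ K * (c * (1 / 2) ^ d) :=
      (div_le_iff₀ (by positivity)).1 (le_max_right _ _)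
    have h2 : (1 / 2 : ℝ) ^ d ≤ (K / 2) ^ d := by gcongr
    calc 4 / lam ≤ K * (c * (1 / 2) ^ d) := h1
      _ ≤ K * (c * (K / 2) ^ d) := by gcongr
      _ = c * (K / 2) ^ d * K := by ring
  filter_upwards [eventually_le_log 48, eventually_le_log (4 * V * 2 ^ d / (δ * c)),
    eventually_le_log (2 * B * unitVol d * (d + 1) * 4 * (K + 4) ^ d),
    eventually_le_log ((Cup * (K + 12) ^ 2 + Cα * (K + 4)) / lam),
    eventually_le_log (Cα * (K + 4) / B), eventually_le_log (2 * Cα / B),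
    eventually_le_log (40 * B / (Clow * C₀ ^ 2 * σ ^ 2)),
    eventually_mul_exp_le ha 1 (b := 1 / 8) (by norm_num),
    eventually_mul_exp_le ha (4 * B * unitVol d) one_pos,
    eventually_mul_exp_le ha (2 * (K + 4) + 4) one_pos,
    eventually_mul_exp_le ha (K + 12) hrM, eventually_mul_exp_le ha (10 * B) hγ,
    Filter.eventually_gt_atTop 0] with n hL48 hLV hLsh hLosc hLB1 hLB2 hLC huL huW hufit hurM huγ hn
  intro k hk
  set L := Real.log n with hLdef
  have hL0 : 0 < L := by linarith
  have hn' : (0 : ℝ) < n := Nat.cast_pos.2 hn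
  have hu2 : Real.exp (-(α / q * L)) ≤ 1 / 2 := by
    have := le_mul_of_one_le_right (Real.exp_pos (-(α / q * L))).le (by linarith : 1 ≤ L)
    linarith
  obtain ⟨s, u, w, A, hu, hs0, hsu, hw0, hA0, hsα, hw2, hAu, hkl, hku, hsA, hnw, hfin⟩ :=
    exists_scales d hα hα1 hn hL48 hu2 hk
  rw [← hu] at hu2 huL huW hufit hurM huγ
  have hu0 : 0 < u := hs0.trans_le hsu
  have huL1 : u * L ≤ 1 / 8 := by linarith
  have hu1 : u ≤ 1 := by linarith
  have hs1 : s ≤ 1 := hsu.trans hu1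
  -- each bound on `C * (u * L)` yields one on `C * u`, as `L ≥ 1`
  have hdrop : ∀ C b : ℝ, 0 ≤ C → C * (u * L) ≤ b → C * u ≤ b := fun C b hC h =>
    le_trans (mul_le_mul_of_nonneg_left (le_mul_of_one_le_right hu0.le (by linarith)) hC) h
  have hk0' : (0 : ℝ) < k := by linarith
  have hk0 : 0 < k := by exact_mod_cast hk0'
  have hkl' : s ^ (d + 1) / 2 ≤ k / n := by
    rw [hsA, div_right_comm]
    gcongr
  have hku' : k / n ≤ 2 * s ^ (d + 1) := by
    rw [hsA, ← mul_div_assoc]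
    gcongr
  have hmu : 1 / ((k ^ 2 : ℕ) : ℝ) ≤ 4 * u := by
    push_cast
    calc 1 / (k : ℝ) ^ 2 ≤ 1 / (A / 2) ^ 2 := by gcongr
      _ = 4 * (u ^ 2) ^ 2 := by
          rw [eq_div_of_mul_eq hA0.ne' ((mul_comm _ _).trans hAu)]
          field_simp
          norm_num
      _ ≤ 4 * u := by
          rw [← pow_mul]
          gcongr
          exact pow_le_of_le_one hu0.le hu1 (by norm_num)
  have hadm := admissibleScales_of_le (d := d) (c := c) (rM := rM) hα hα1 hCα hCup hlam hB hn hk0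
    (pow_pos hk0 2) hs0 hsu hu1 hsα.le hL0 hK1 hkl' hku' hmu hK (by linarith)
    (hdrop _ _ (mul_nonneg (by positivity) (unitVol_nonneg d)) huW) hLsh
    (hdrop _ _ (by positivity) hufit) (hdrop _ _ (by positivity) hurM)
    ((div_le_iff₀ hlam).1 hLosc)
  refine ⟨u * L, s ^ 2, K * s, C₀ * (σ * L * w) / 2, hadm, pow_le_one₀ hs0.le hs1, ?_, ?_, ?_, ?_⟩
  · positivity
  · rw [hnw, div_inv_eq_mul]
    ring
  · refine (density_drop_le hα hα1 hCα.le hK1 hs0 hs1 hsα.le ((div_le_iff₀ hB).1 hLB1)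
      ((div_le_iff₀ hB).1 hLB2)).trans (le_min huγ ?_)
    have e3 := (div_le_iff₀ (by positivity)).1 hLC
    calc 10 * B * (u * L) = (40 * B) * (u * L / 4) := by ring
      _ ≤ (L * (Clow * C₀ ^ 2 * σ ^ 2)) * (u * L / 4) := by gcongr
      _ = Clow * (C₀ * (σ * L * w) / 2) ^ 2 := by
          rw [← hw2]
          ring
  · exact union_count_le hc hδ hV ((div_le_iff₀ (by positivity)).1 hLV) hAu hk0'.le hkl hku hfin

end CondMode

end

theorem mainTheorem8 (d : ℕ) (α Cα Clow Cup rM lam c C₀ δ : ℝ)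
    (hα : 0 < α) (hα1 : α ≤ 1) (hCα : 0 < Cα) (hClow : 0 < Clow) (hCup : 0 < Cup)
    (hrM : 0 < rM) (hlam : 0 < lam) (hc : 0 < c) (hC₀ : 0 < C₀) (hδ : 0 < δ) (hδ1 : δ < 1) :
    ∃ N : ℝ → ℝ → ℕ,
      ∀ (𝒳 : Set (CondMode.Ctx d)) (f : ℝ → CondMode.Ctx d → ℝ) (mode : CondMode.Ctx d → ℝ),
        IsCompact 𝒳 →
        CondMode.IsThick 𝒳 c →
        CondMode.IsJointDensity 𝒳 f →
        CondMode.ConditionalRegularity 𝒳 f α Cα Clow Cup rM lam →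
        (∀ x ∈ 𝒳, CondMode.IsTheMode (CondMode.condDensity f x) (mode x)) →
        (∃ B γ : ℝ, 0 < γ ∧ CondMode.IsSupBound 𝒳 f B ∧ CondMode.IsModeGap 𝒳 f mode rM γ) ∧
        ∀ B γ : ℝ, 0 < γ → CondMode.IsSupBound 𝒳 f B → CondMode.IsModeGap 𝒳 f mode rM γ →
          ∀ n : ℕ, N B γ ≤ n →
          ∀ k : ℕ, |(k : ℝ) - (n : ℝ) ^ (2 * α / (2 * α + d + 1))| < 1 →
          ∀ modeHat : (Fin n → ℝ × CondMode.Ctx d) → CondMode.Ctx d → ℝ,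
            (∀ S, ∀ x ∈ 𝒳, CondMode.IsModeEstimate S k (k ^ 2) x (modeHat S x)) →
            MeasureTheory.Measure.pi (fun _ : Fin n => CondMode.jointLaw 𝒳 f)
              {S | C₀ * (Real.sqrt (Real.log (1 / δ)) * Real.log n
                      / (n : ℝ) ^ (α / (4 * α + 2 * d + 2)))
                    ≤ ⨆ x : 𝒳, |modeHat S x - mode x|}
              ≤ ENNReal.ofReal δ := by
  set V : ℝ := 1 / (lam * min rM (1 / 2))
  have hV : 0 ≤ V := by positivity
  have hN : ∀ B γ : ℝ, ∃ N : ℕ, 0 < B → 0 < γ → ∀ n : ℕ, N ≤ n → ∀ k : ℕ,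
      |(k : ℝ) - (n : ℝ) ^ (2 * α / (2 * α + d + 1))| < 1 →
      ∃ τ η R ε : ℝ, CondMode.AdmissibleScales d α Cα Cup rM lam c B n k (k ^ 2) τ η R ∧
        η ≤ 1 ∧ 0 < ε ∧
        2 * ε = C₀ * (Real.sqrt (Real.log (1 / δ)) * Real.log n
                  / (n : ℝ) ^ (α / (4 * α + 2 * d + 2))) ∧
        8 * τ * B + Cα * (R + 4 * η) ^ α + 2 * (Cα * η ^ α) ≤ min γ (Clow * ε ^ 2) ∧
        V * (k ^ 2 * Real.exp (-(k * τ ^ 2 / 8))) ≤ δ * (c * (η / 2) ^ d) := by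
    intro B γ
    by_cases h : 0 < B ∧ 0 < γ
    · obtain ⟨N, hN⟩ := Filter.eventually_atTop.1
        (CondMode.eventually_exists_admissibleScales d hα hα1 hCα hClow hCup hrM hlam hc hC₀ hδ hδ1
          h.1 h.2 hV)
      exact ⟨N, fun _ _ => hN⟩
    · exact ⟨0, fun h1 h2 => absurd ⟨h1, h2⟩ h⟩
  choose N hN using hN
  refine ⟨N, fun 𝒳 f mode h𝒳 hth hf hreg hmode => ?_⟩
  have hm𝒳 := h𝒳.measurableSet
  have hcont := CondMode.continuousOn_of_holder hα hreg.holder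
  have hmodef := fun x hx => (hmode x hx).of_condDensity hf hx
  refine ⟨?_, fun B γ hγ hB hgap n hn k hk modeHat hhat => ?_⟩
  · obtain ⟨B, hB⟩ := CondMode.exists_isSupBound h𝒳 hcont
    obtain ⟨γ, hγ, hgap⟩ := CondMode.exists_isModeGap h𝒳 hrM hcont hmodef
    exact ⟨B, γ, hγ, hB, hgap⟩
  have hlow : ∀ x ∈ 𝒳, ∀ r ∈ Icc (0 : ℝ) 1, |r - mode x| ≤ rM → lam ≤ f r x :=
    fun x hx => hreg.lower x hx _ (hmode x hx).isLocalMode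
  -- a density on `[0,1] × 𝒳` cannot live on the empty set
  obtain ⟨x₀, hx₀⟩ : 𝒳.Nonempty := by
    by_contra h
    have := hf.2
    simp [not_nonempty_iff_eq_empty.1 h] at this
  have hB0 : 0 < B := hlam.trans_le ((hlow x₀ hx₀ _ (hmode x₀ hx₀).1 (by simpa using hrM.le)).trans
    (hB x₀ hx₀ _ (hmode x₀ hx₀).1))
  obtain ⟨τ, η, R, ε, hs, hη1, hε, hεT, hdrop, hcount⟩ := hN B γ hB0 hγ n hn k hk
  have hvol := CondMode.volume_contexts_le hm𝒳 hf hrM hlam hcont (fun x hx => (hmode x hx).1) hlow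
  obtain ⟨T, hT, hnet, hcard⟩ := CondMode.exists_net hm𝒳 hc hth hV hvol hs.eta_pos hη1
  have hfar : ∀ x ∈ 𝒳, ∀ r ∈ Icc (0 : ℝ) 1, ε ≤ |r - mode x| →
      f r x + (8 * τ * B + Cα * (R + 4 * η) ^ α + 2 * (Cα * η ^ α)) ≤ f (mode x) x := by
    intro x hx r hr hd
    rcases le_total |r - mode x| rM with h | h
    · have h1 := (hreg.quadratic x hx _ (hmode x hx).isLocalMode r hr h).1
      have hne : r ≠ mode x := by
        rintro rfl
        simp only [sub_self, abs_zero] at hd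
        linarith
      rw [abs_of_pos (sub_pos.2 ((hmodef x hx).2 r hr hne))] at h1
      have h2 : Clow * ε ^ 2 ≤ Clow * (mode x - r) ^ 2 := by
        rw [← sq_abs (mode x - r), abs_sub_comm]
        gcongr
      linarith [hdrop.trans (min_le_right _ _)]
    · linarith [hgap x hx r hr h, hdrop.trans (min_le_left _ _)]
  have hmain := CondMode.pi_exists_far_le hα hCα hCup hlam hrM hm𝒳 hth hf hreg hmode hB hs hfar hT
    hnet hhat
  refine (measure_mono ?_).trans (hmain.trans (ENNReal.ofReal_le_ofReal ?_))
  · intro S hS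
    simp only [mem_ofPred_eq] at hS ⊢
    by_contra! hall
    have : Nonempty 𝒳 := ⟨⟨x₀, hx₀⟩⟩
    have hsup : ⨆ x : 𝒳, |modeHat S x - mode x| ≤ ε := ciSup_le fun x => (hall x x.2).le
    linarith
  · have hb : 0 < c * (η / 2) ^ d := by
      have := hs.eta_pos
      positivity
    refine le_of_mul_le_mul_right ?_ hb
    calc T.card * ((k ^ 2 : ℕ) : ℝ) * Real.exp (-(k * τ ^ 2 / 8)) * (c * (η / 2) ^ d)
        = (T.card * (c * (η / 2) ^ d)) * (k ^ 2 * Real.exp (-(k * τ ^ 2 / 8))) := by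
          push_cast
          ring
      _ ≤ V * (k ^ 2 * Real.exp (-(k * τ ^ 2 / 8))) := by gcongr
      _ ≤ δ * (c * (η / 2) ^ d) := hcount
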